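/- Let $\mathbb{T}^1=\mathbb{R}/2\pi\mathbb{Z}$, let $c,q\in C^\infty(\mathbb{T}^1)$ be complex-valued, and let $L=\partial_t+c(t)\partial_x+q(t)$ on $\mathbb{T}^1\times\mathbb{R}$. Put $b=\operatorname{Im}c$, $c_0=\frac1{2\pi}\int_0^{2\pi}c(t)\,dt$ and $q_0=\frac1{2\pi}\int_0^{2\pi}q(t)\,dt$. Let $\mathcal{S}(\mathbb{T}^1\times\mathbb{R})$ be the space of all $f\in C^\infty(\mathbb{T}^1\times\mathbb{R})$ such that $\|f\|_{\alpha,\beta,\gamma}=\sup_{t,x}|x^\gamma\partial_t^\alpha\partial_x^\beta f(t,x)|<\infty$ for all $\alpha,\beta,\gamma\in\mathbb{N}_0$. Let $\mathcal{S}'(\mathbb{T}^1\times\mathbb{R})$ be the space of linear functionals $v$ on it such that, for some $N\in\mathbb{N}_0$ and $C>0$, $|\langle v,f\rangle|\le C\sum_{\alpha+\beta+\gamma\le N}\|f\|_{\alpha,\beta,\gamma}$ for every $f$. Let ${}^tL$ be the transpose of $L$, $\langle {}^tLv,f\rangle=\langle v,Lf\rangle$, and let $$(\ker{}^tL)^0=\{f\in\mathcal{S}(\mathbb{T}^1\times\mathbb{R})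 : \langle v,f\rangle=0\ \text{for all } v\in\mathcal{S}'(\mathbb{T}^1\times\mathbb{R})\text{ with }{}^tLv=0\}.$$ Say that $L$ is Schwartz globally solvable if for every $f\in(\ker{}^tL)^0$ there is $u\in\mathcal{S}(\mathbb{T}^1\times\mathbb{R})$ with $Lu=f$. 1. If $c_0=0$, $q_0\in i\mathbb{Z}$ and for every $r\in\mathbb{R}$ the sublevel set $\Omega_r=\{t\in\mathbb{T}^1 : \int_0^t b(\tau)\,d\tau<r\}$ is connected (the empty set being counted as connected), then $L$ is Schwartz globally solvable. 2. If $b\not\equiv0$, and either $c_0\neq0$ or $q_0\notin i\mathbb{Z}$, then $L$ is Schwartz globally solvable if and only if $b$ does not change sign, that is, $b\ge0$ everywhere or $b\le0$ everywhere. -/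

import Mathlib

open scoped ContDiff

noncomputable section

namespace TorusLine

/-! Functions on `𝕋¹ × ℝ`, with `𝕋¹ = ℝ / 2πℤ`, are functions on `ℝ × ℝ` that are
`2π`-periodic in the first variable `t`. -/

/-- The partial derivative `∂_t f`. -/
def dt (f : ℝ × ℝ → ℂ) : ℝ × ℝ → ℂ := fun p => deriv (fun s : ℝ => f (s, p.2)) p.1

/-- The partial derivative `∂_x f`. -/
def dx (f : ℝ × ℝ → ℂ) : ℝ × ℝ → ℂ := fun p => deriv (fun y : ℝ => f (p.1, y)) p.2

/-- The Schwartz functions on `𝕋¹ × ℝ`: smooth functions such that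
`x ^ γ ∂_t ^ α ∂_x ^ β f` is bounded for all `α β γ`. -/
structure IsSchwartz (f : ℝ × ℝ → ℂ) : Prop where
  smooth : ContDiff ℝ ∞ f
  periodic : ∀ t x : ℝ, f (t + 2 * Real.pi, x) = f (t, x)
  decay : ∀ α β γ : ℕ, ∃ C : ℝ, ∀ p : ℝ × ℝ, |p.2| ^ γ * ‖dt^[α] (dx^[β] f) p‖ ≤ C

/-- The smooth complex-valued functions on `𝕋¹`. -/
structure SmoothCircleFun where
  toFun : ℝ → ℂ
  smooth : ContDiff ℝ ∞ toFun
  periodic : Function.Periodic toFun (2 * Real.pi)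

instance : CoeFun SmoothCircleFun (fun _ => ℝ → ℂ) := ⟨SmoothCircleFun.toFun⟩

section Helpers

theorem dt_eq {f : ℝ × ℝ → ℂ} (hf : ContDiff ℝ ∞ f) :
    dt f = fun p => fderiv ℝ f p (1, 0) := by
  funext p
  have h1 : HasFDerivAt f (fderiv ℝ f p) (p.1, p.2) :=
    (hf.differentiable (by simp) p).hasFDerivAt
  exact (h1.comp_hasDerivAt p.1 ((hasDerivAt_id p.1).prodMk (hasDerivAt_const p.1 p.2))).deriv

theorem dx_eq {f : ℝ × ℝ → ℂ} (hf : ContDiff ℝ ∞ f) :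
    dx f = fun p => fderiv ℝ f p (0, 1) := by
  funext p
  have h1 : HasFDerivAt f (fderiv ℝ f p) (p.1, p.2) :=
    (hf.differentiable (by simp) p).hasFDerivAt
  exact (h1.comp_hasDerivAt p.2 ((hasDerivAt_const p.2 p.1).prodMk (hasDerivAt_id p.2))).deriv

theorem smooth_fderiv_apply {f : ℝ × ℝ → ℂ} (hf : ContDiff ℝ ∞ f) (v : ℝ × ℝ) :
    ContDiff ℝ ∞ (fun p => fderiv ℝ f p v) :=
  (hf.fderiv_right (m := ∞) (by simp)).clm_apply contDiff_const

theorem smooth_dt {f : ℝ × ℝ → ℂ} (hf : ContDiff ℝ ∞ f) : ContDiff ℝ ∞ (dt f) := by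
  rw [dt_eq hf]; exact smooth_fderiv_apply hf _

theorem smooth_dx {f : ℝ × ℝ → ℂ} (hf : ContDiff ℝ ∞ f) : ContDiff ℝ ∞ (dx f) := by
  rw [dx_eq hf]; exact smooth_fderiv_apply hf _

theorem smooth_dt_iter {f : ℝ × ℝ → ℂ} (hf : ContDiff ℝ ∞ f) (n : ℕ) :
    ContDiff ℝ ∞ (dt^[n] f) := by
  induction n with
  | zero => exact hf
  | succ n ih => rw [Function.iterate_succ_apply']; exact smooth_dt ih

theorem smooth_dx_iter {f : ℝ × ℝ → ℂ} (hf : ContDiff ℝ ∞ f) (n : ℕ) :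
    ContDiff ℝ ∞ (dx^[n] f) := by
  induction n with
  | zero => exact hf
  | succ n ih => rw [Function.iterate_succ_apply']; exact smooth_dx ih

theorem dx_dt_comm {f : ℝ × ℝ → ℂ} (hf : ContDiff ℝ ∞ f) : dx (dt f) = dt (dx f) := by
  rw [dx_eq (smooth_dt hf), dt_eq (smooth_dx hf), dt_eq hf, dx_eq hf]
  funext p
  have hd : DifferentiableAt ℝ (fderiv ℝ f) p :=
    (hf.fderiv_right (m := ∞) (by simp)).differentiable (by simp) p
  have hs : IsSymmSndFDerivAt ℝ f p :=
    hf.contDiffAt.isSymmSndFDerivAt (by simpa using WithTop.coe_le_coe.2 (le_top : (2 : ℕ∞) ≤ ⊤))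
  rw [fderiv_clm_apply hd (differentiableAt_const _),
    fderiv_clm_apply hd (differentiableAt_const _)]
  simpa using hs.eq (0, 1) (1, 0)

theorem dx_iter_dt {f : ℝ × ℝ → ℂ} (hf : ContDiff ℝ ∞ f) (n : ℕ) :
    dx^[n] (dt f) = dt (dx^[n] f) := by
  induction n with
  | zero => rfl
  | succ n ih =>
    rw [Function.iterate_succ_apply', Function.iterate_succ_apply', ih,
      dx_dt_comm (smooth_dx_iter hf n)]

theorem dt_add {f g : ℝ × ℝ → ℂ} (hf : ContDiff ℝ ∞ f) (hg : ContDiff ℝ ∞ g) :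
    dt (f + g) = dt f + dt g := by
  have h : ContDiff ℝ ∞ (f + g) := hf.add hg
  rw [dt_eq h, dt_eq hf, dt_eq hg]
  funext p
  rw [fderiv_add (hf.differentiable (by simp) p) (hg.differentiable (by simp) p)]
  rfl

theorem dx_add {f g : ℝ × ℝ → ℂ} (hf : ContDiff ℝ ∞ f) (hg : ContDiff ℝ ∞ g) :
    dx (f + g) = dx f + dx g := by
  have h : ContDiff ℝ ∞ (f + g) := hf.add hg
  rw [dx_eq h, dx_eq hf, dx_eq hg]
  funext p
  rw [fderiv_add (hf.differentiable (by simp) p) (hg.differentiable (by simp) p)]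
  rfl

theorem dt_smul (a : ℂ) (f : ℝ × ℝ → ℂ) : dt (a • f) = a • dt f := by
  funext p
  exact deriv_const_smul_field (x := p.1) a (fun s : ℝ => f (s, p.2))

theorem dx_smul (a : ℂ) (f : ℝ × ℝ → ℂ) : dx (a • f) = a • dx f := by
  funext p
  exact deriv_const_smul_field (x := p.2) a (fun y : ℝ => f (p.1, y))

theorem dt_iter_add {f g : ℝ × ℝ → ℂ} (hf : ContDiff ℝ ∞ f) (hg : ContDiff ℝ ∞ g) (n : ℕ) :
    dt^[n] (f + g) = dt^[n] f + dt^[n] g := by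
  induction n with
  | zero => rfl
  | succ n ih =>
    simp only [Function.iterate_succ_apply', ih]
    exact dt_add (smooth_dt_iter hf n) (smooth_dt_iter hg n)

theorem dx_iter_add {f g : ℝ × ℝ → ℂ} (hf : ContDiff ℝ ∞ f) (hg : ContDiff ℝ ∞ g) (n : ℕ) :
    dx^[n] (f + g) = dx^[n] f + dx^[n] g := by
  induction n with
  | zero => rfl
  | succ n ih =>
    simp only [Function.iterate_succ_apply', ih]
    exact dx_add (smooth_dx_iter hf n) (smooth_dx_iter hg n)

theorem dt_iter_smul (a : ℂ) (f : ℝ × ℝ → ℂ) (n : ℕ) : dt^[n] (a • f) = a • dt^[n] f := by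
  induction n with
  | zero => rfl
  | succ n ih => simp only [Function.iterate_succ_apply', ih, dt_smul]

theorem dx_iter_smul (a : ℂ) (f : ℝ × ℝ → ℂ) (n : ℕ) : dx^[n] (a • f) = a • dx^[n] f := by
  induction n with
  | zero => rfl
  | succ n ih => simp only [Function.iterate_succ_apply', ih, dx_smul]

theorem IsSchwartz.add {f g : ℝ × ℝ → ℂ} (hf : IsSchwartz f) (hg : IsSchwartz g) :
    IsSchwartz (f + g) where
  smooth := hf.smooth.add hg.smooth
  periodic t x := by simp [hf.periodic, hg.periodic]
  decay α β γ := by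
    obtain ⟨C, hC⟩ := hf.decay α β γ
    obtain ⟨D, hD⟩ := hg.decay α β γ
    refine ⟨C + D, fun p => ?_⟩
    rw [dx_iter_add hf.smooth hg.smooth,
      dt_iter_add (smooth_dx_iter hf.smooth β) (smooth_dx_iter hg.smooth β)]
    calc _ ≤ |p.2| ^ γ * (‖dt^[α] (dx^[β] f) p‖ + ‖dt^[α] (dx^[β] g) p‖) :=
          mul_le_mul_of_nonneg_left (norm_add_le _ _) (by positivity)
      _ ≤ C + D := by rw [mul_add]; exact add_le_add (hC p) (hD p)

theorem IsSchwartz.smul (a : ℂ) {f : ℝ × ℝ → ℂ} (hf : IsSchwartz f) : IsSchwartz (a • f) where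
  smooth := contDiff_const.smul hf.smooth
  periodic t x := by simp [hf.periodic]
  decay α β γ := by
    obtain ⟨C, hC⟩ := hf.decay α β γ
    refine ⟨‖a‖ * C, fun p => ?_⟩
    rw [dx_iter_smul, dt_iter_smul, Pi.smul_apply, norm_smul, mul_left_comm]
    exact mul_le_mul_of_nonneg_left (hC p) (norm_nonneg _)

theorem isSchwartz_zero : IsSchwartz 0 where
  smooth := contDiff_const
  periodic _ _ := rfl
  decay α β γ := by
    have h := dx_iter_smul 0 0 β
    have h' := dt_iter_smul 0 0 α
    simp only [zero_smul] at h h'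
    exact ⟨0, fun p => by simp [h, h']⟩

theorem IsSchwartz.dt {f : ℝ × ℝ → ℂ} (hf : IsSchwartz f) : IsSchwartz (dt f) where
  smooth := smooth_dt hf.smooth
  periodic t x := by
    have h : (fun s : ℝ => f (s + 2 * Real.pi, x)) = fun s => f (s, x) :=
      funext fun s => hf.periodic s x
    exact (deriv_comp_add_const (fun s : ℝ => f (s, x)) (2 * Real.pi) t).symm.trans
      (by rw [h]; rfl)
  decay α β γ := by
    obtain ⟨C, hC⟩ := hf.decay (α + 1) β γ
    exact ⟨C, by rw [dx_iter_dt hf.smooth]; exact hC⟩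

theorem IsSchwartz.dx {f : ℝ × ℝ → ℂ} (hf : IsSchwartz f) : IsSchwartz (dx f) where
  smooth := smooth_dx hf.smooth
  periodic t x := by
    have h : (fun y : ℝ => f (t + 2 * Real.pi, y)) = fun y => f (t, y) :=
      funext fun y => hf.periodic t y
    exact congrArg (fun g : ℝ → ℂ => deriv g x) h
  decay α β γ := hf.decay α (β + 1) γ

theorem IsSchwartz.dx_iter {f : ℝ × ℝ → ℂ} (hf : IsSchwartz f) (n : ℕ) :
    IsSchwartz (TorusLine.dx^[n] f) := by
  induction n with
  | zero => exact hf
  | succ n ih => rw [Function.iterate_succ_apply']; exact ih.dx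

/-- The derivative of a smooth function on `𝕋¹`. -/
def SmoothCircleFun.der (c : SmoothCircleFun) : SmoothCircleFun where
  toFun := deriv c
  smooth := c.smooth.iterate_deriv 1
  periodic t := by
    have h : (fun s : ℝ => c (s + 2 * Real.pi)) = c := funext c.periodic
    rw [← deriv_comp_add_const, h]

theorem SmoothCircleFun.bounded (c : SmoothCircleFun) : ∃ C : ℝ, ∀ t, ‖c t‖ ≤ C := by
  obtain ⟨C, hC⟩ := (c.periodic.isBounded_of_continuous (by positivity)
    c.smooth.continuous).exists_norm_le
  exact ⟨C, fun t => hC _ ⟨t, rfl⟩⟩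

theorem SmoothCircleFun.smooth_mul (c : SmoothCircleFun) {f : ℝ × ℝ → ℂ}
    (hf : ContDiff ℝ ∞ f) : ContDiff ℝ ∞ (fun p : ℝ × ℝ => c p.1 * f p) :=
  (c.smooth.comp contDiff_fst).mul hf

theorem dx_mul (c : SmoothCircleFun) (f : ℝ × ℝ → ℂ) :
    dx (fun p => c p.1 * f p) = fun p => c p.1 * dx f p := by
  funext p
  exact deriv_const_mul_field (x := p.2) (v := fun y : ℝ => f (p.1, y)) (c p.1)

theorem dx_iter_mul (c : SmoothCircleFun) (f : ℝ × ℝ → ℂ) (n : ℕ) :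
    dx^[n] (fun p => c p.1 * f p) = fun p => c p.1 * dx^[n] f p := by
  induction n with
  | zero => rfl
  | succ n ih => rw [Function.iterate_succ_apply', ih, dx_mul, Function.iterate_succ_apply']

theorem dt_mul (c : SmoothCircleFun) {f : ℝ × ℝ → ℂ} (hf : ContDiff ℝ ∞ f) :
    dt (fun p => c p.1 * f p) =
      (fun p : ℝ × ℝ => c.der p.1 * f p) + fun p : ℝ × ℝ => c p.1 * dt f p := by
  funext p
  have h1 : DifferentiableAt ℝ (fun s : ℝ => f (s, p.2)) p.1 :=
    (hf.comp (contDiff_id.prodMk contDiff_const)).differentiable (by simp) p.1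
  exact deriv_fun_mul (c.smooth.differentiable (by simp) p.1) h1

theorem mul_decay (α γ : ℕ) : ∀ (c : SmoothCircleFun) {f : ℝ × ℝ → ℂ}, IsSchwartz f →
    ∃ C : ℝ, ∀ p : ℝ × ℝ, |p.2| ^ γ * ‖dt^[α] (fun p : ℝ × ℝ => c p.1 * f p) p‖ ≤ C := by
  induction α with
  | zero =>
    intro c f hf
    obtain ⟨A, hA⟩ := c.bounded
    obtain ⟨C, hC⟩ := hf.decay 0 0 γ
    refine ⟨A * C, fun p => ?_⟩
    have h0 : 0 ≤ A := (norm_nonneg _).trans (hA 0)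
    calc |p.2| ^ γ * ‖c p.1 * f p‖ = ‖c p.1‖ * (|p.2| ^ γ * ‖f p‖) := by
          rw [norm_mul]; ring
      _ ≤ A * C := mul_le_mul (hA _) (hC p) (by positivity) h0
  | succ n ih =>
    intro c f hf
    obtain ⟨A, hA⟩ := ih c.der hf
    obtain ⟨B, hB⟩ := ih c hf.dt
    refine ⟨A + B, fun p => ?_⟩
    rw [Function.iterate_succ_apply, dt_mul c hf.smooth,
      dt_iter_add (c.der.smooth_mul hf.smooth) (c.smooth_mul (smooth_dt hf.smooth))]
    refine (mul_le_mul_of_nonneg_left (norm_add_le _ _) (by positivity)).trans ?_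
    rw [mul_add]
    exact add_le_add (hA p) (hB p)

theorem IsSchwartz.mul (c : SmoothCircleFun) {f : ℝ × ℝ → ℂ} (hf : IsSchwartz f) :
    IsSchwartz (fun p => c p.1 * f p) where
  smooth := c.smooth_mul hf.smooth
  periodic t x := by simp only [hf.periodic, c.periodic t]
  decay α β γ := by
    rw [dx_iter_mul]
    exact mul_decay α γ c (hf.dx_iter β)

end Helpers

/-- The Schwartz space `𝒮(𝕋¹ × ℝ)`. -/
def SchwartzTR : Submodule ℂ (ℝ × ℝ → ℂ) where
  carrier := {f | IsSchwartz f}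
  add_mem' := IsSchwartz.add
  zero_mem' := isSchwartz_zero
  smul_mem' a _ hf := hf.smul a

/-- `‖f‖_{α,β,γ} = sup |x ^ γ ∂_t ^ α ∂_x ^ β f|` (a supremum of a bounded set). -/
def seminormTR (α β γ : ℕ) (f : SchwartzTR) : ℝ :=
  ⨆ p : ℝ × ℝ, |p.2| ^ γ * ‖dt^[α] (dx^[β] (f : ℝ × ℝ → ℂ)) p‖

theorem seminormTR_bddAbove (α β γ : ℕ) (f : SchwartzTR) :
    BddAbove (Set.range fun p : ℝ × ℝ => |p.2| ^ γ * ‖dt^[α] (dx^[β] (f : ℝ × ℝ → ℂ)) p‖) := by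
  obtain ⟨C, hC⟩ := f.2.decay α β γ
  exact ⟨C, by rintro _ ⟨p, rfl⟩; exact hC p⟩

/-- `p_N(f) = ∑_{α + β + γ ≤ N} ‖f‖_{α,β,γ}`. -/
def pN (N : ℕ) (f : SchwartzTR) : ℝ :=
  ∑ i ∈ (Finset.range (N + 1) ×ˢ Finset.range (N + 1) ×ˢ Finset.range (N + 1)).filter
    (fun i => i.1 + i.2.1 + i.2.2 ≤ N), seminormTR i.1 i.2.1 i.2.2 f

/-- A linear functional on `𝒮(𝕋¹ × ℝ)` is a tempered distribution, i.e. belongs to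
`𝒮'(𝕋¹ × ℝ)`, if it is bounded by a multiple of some `p_N`. -/
def IsTempered (v : SchwartzTR →ₗ[ℂ] ℂ) : Prop :=
  ∃ (N : ℕ) (C : ℝ), ∀ f : SchwartzTR, ‖v f‖ ≤ C * pN N f

/-- `∂_t` on `𝒮(𝕋¹ × ℝ)`. -/
def dtS : SchwartzTR →ₗ[ℂ] SchwartzTR where
  toFun f := ⟨dt f, f.2.dt⟩
  map_add' f g := Subtype.ext (dt_add f.2.smooth g.2.smooth)
  map_smul' a f := Subtype.ext (dt_smul a f)

/-- `∂_x` on `𝒮(𝕋¹ × ℝ)`. -/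
def dxS : SchwartzTR →ₗ[ℂ] SchwartzTR where
  toFun f := ⟨dx f, f.2.dx⟩
  map_add' f g := Subtype.ext (dx_add f.2.smooth g.2.smooth)
  map_smul' a f := Subtype.ext (dx_smul a f)

/-- Multiplication by a smooth function of `t` on `𝒮(𝕋¹ × ℝ)`. -/
def mulS (c : SmoothCircleFun) : SchwartzTR →ₗ[ℂ] SchwartzTR where
  toFun f := ⟨fun p => c p.1 * (f : ℝ × ℝ → ℂ) p, f.2.mul c⟩
  map_add' _ _ := Subtype.ext (funext fun _ => mul_add _ _ _)
  map_smul' _ _ := Subtype.ext (funext fun _ => mul_left_comm _ _ _)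

/-- The operator `L = ∂_t + c(t) ∂_x + q(t)` on `𝒮(𝕋¹ × ℝ)`. -/
def opL (c q : SmoothCircleFun) : SchwartzTR →ₗ[ℂ] SchwartzTR :=
  dtS + mulS c ∘ₗ dxS + mulS q

/-- The transpose of `L`, acting on functionals: `⟨ᵗL v, f⟩ = ⟨v, L f⟩`. -/
def transposeL (c q : SmoothCircleFun) (v : SchwartzTR →ₗ[ℂ] ℂ) : SchwartzTR →ₗ[ℂ] ℂ :=
  v ∘ₗ opL c q

/-- `(ker ᵗL)⁰`: the Schwartz functions annihilated by every tempered distribution `v`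
with `ᵗL v = 0`. -/
def kerTransposeAnnihilator (c q : SmoothCircleFun) : Set SchwartzTR :=
  {f | ∀ v : SchwartzTR →ₗ[ℂ] ℂ, IsTempered v → transposeL c q v = 0 → v f = 0}

/-- `L` is Schwartz globally solvable. -/
def GloballySolvable (c q : SmoothCircleFun) : Prop :=
  ∀ f ∈ kerTransposeAnnihilator c q, ∃ u : SchwartzTR, opL c q u = f

/-- The mean `(1 / 2π) ∫₀^{2π} c(t) dt`. -/
def mean (c : SmoothCircleFun) : ℂ := (1 / (2 * Real.pi) : ℂ) * ∫ t in (0 : ℝ)..2 * Real.pi, c t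

/-- The sublevel set `Ω_r = {t ∈ 𝕋¹ | ∫₀ᵗ b < r}` as a subset of the circle `ℝ / 2πℤ`
(used for `b` of mean zero, where the integral does not depend on the representative `t`). -/
def sublevel (b : ℝ → ℝ) (r : ℝ) : Set (AddCircle (2 * Real.pi)) :=
  (fun t : ℝ => (t : AddCircle (2 * Real.pi))) '' {t : ℝ | ∫ τ in (0 : ℝ)..t, b τ < r}

end TorusLine

end

open scoped ContDiff FourierTransform
open MeasureTheory Complex

noncomputable section

namespace TorusLine

/-! The partial Fourier transform in `x` preserves the Schwartz space and turns `L` into `symP`, the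
family of ordinary differential operators `∂_t + 2πi x c(t) + q(t)`, where `x` is now the frequency.
With `Φ = phase c q`, every solution of `symP c q U = F` has the form `e^{-Φ}(∫₀ᵗ e^Φ F + κ(x))`. It
is periodic exactly when `∫₀^{2π} e^Φ F = (e^{Φ(2π,x)} - 1) κ(x)`. At a resonant frequency,
`e^{Φ(2π,x)} = 1`, the left side is a tempered functional of `f` killed by the transpose
(`modeFunctional`), so it vanishes for `f` in the annihilator.

Solvability thus reduces to a smooth `κ` for which `U` is Schwartz. By `isSchwartz_of_apriori` it is
enough to bound the `x`-derivatives of `U` by their sources, uniformly for large `|x|`. Writing `B =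
Im ∫₀ᵗ c`, transport from `s` to `t` has modulus `exp(-2πx(B(s) - B(t)) + O(1))`, so one needs paths
ending at `t` along which `x(B - B(t)) ≥ 0`.

If every frequency is resonant, `κ` is free. It is chosen so that `U` vanishes at a maximum of `B`
for large positive `x` and at a minimum for negative `x`; connectedness of the sublevel sets then
makes one of the two arcs to `t` admissible (`exists_arc_ge`, `exists_arc_le`).

If `b` has one sign and is not identically zero, `B` is monotone with nonzero increment `β` over a
period. Then `e^{Φ(2π,x)} - 1` has at most one zero, a simple one, so `κ` is a smooth quotient.
Transport around a full turn in the favourable direction contracts by `1/2` for large `|x|`, and the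
initial value is absorbed.

If `b` changes sign, `exists_modified_primitives` gives a periodic `C` which is a primitive of `c`
off a set where `Im C` is strictly below its maximum. Cutting `exp(-(2πi x C + Q))` off in `t` near
the top of `Im C` gives a periodic function that grows exponentially in `x`, while its image under
`symP` decays exponentially. That image lies in the closure of the range of `L`, hence in the
annihilator, but uniqueness at nonresonant frequencies forces any solution to grow. -/

/-! ### Rapid decay and multiplication by `x` -/

/-- Rapid decay in `x`, uniformly in `t`. -/
def Decays (f : ℝ × ℝ → ℂ) : Prop :=
  ∀ γ : ℕ, ∃ C : ℝ, ∀ p : ℝ × ℝ, |p.2| ^ γ * ‖f p‖ ≤ C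

theorem Decays.add {f g : ℝ × ℝ → ℂ} (hf : Decays f) (hg : Decays g) : Decays (f + g) := by
  intro γ
  obtain ⟨C, hC⟩ := hf γ
  obtain ⟨D, hD⟩ := hg γ
  refine ⟨C + D, fun p => ?_⟩
  calc _ ≤ |p.2| ^ γ * (‖f p‖ + ‖g p‖) :=
        mul_le_mul_of_nonneg_left (norm_add_le _ _) (by positivity)
    _ ≤ C + D := by rw [mul_add]; exact add_le_add (hC p) (hD p)

theorem Decays.mul_of_bounded {f : ℝ × ℝ → ℂ} (hf : Decays f) {a : ℝ × ℝ → ℂ} {A : ℝ}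
    (ha : ∀ p, ‖a p‖ ≤ A) : Decays (fun p => a p * f p) := by
  intro γ
  obtain ⟨C, hC⟩ := hf γ
  refine ⟨A * C, fun p => ?_⟩
  have h0 : 0 ≤ A := (norm_nonneg _).trans (ha 0)
  calc |p.2| ^ γ * ‖a p * f p‖ = ‖a p‖ * (|p.2| ^ γ * ‖f p‖) := by rw [norm_mul]; ring
    _ ≤ A * C := mul_le_mul (ha _) (hC p) (by positivity) h0

/-- Multiplication by the second variable. -/
def xmul (f : ℝ × ℝ → ℂ) : ℝ × ℝ → ℂ := fun p => (p.2 : ℂ) * f p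

theorem Decays.xmul {f : ℝ × ℝ → ℂ} (hf : Decays f) : Decays (xmul f) := by
  intro γ
  obtain ⟨C, hC⟩ := hf (γ + 1)
  refine ⟨C, fun p => le_trans (le_of_eq ?_) (hC p)⟩
  simp only [TorusLine.xmul, norm_mul, norm_real, Real.norm_eq_abs]
  ring

theorem smooth_xmul {f : ℝ × ℝ → ℂ} (hf : ContDiff ℝ ∞ f) : ContDiff ℝ ∞ (xmul f) :=
  (ofRealCLM.contDiff.comp contDiff_snd).mul hf

theorem dx_xmul {f : ℝ × ℝ → ℂ} (hf : ContDiff ℝ ∞ f) : dx (xmul f) = f + xmul (dx f) := by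
  funext p
  have h1 : DifferentiableAt ℝ (fun y : ℝ => f (p.1, y)) p.2 :=
    (hf.comp (contDiff_const.prodMk contDiff_id)).differentiable (by simp) p.2
  have h2 : HasDerivAt (fun y : ℝ => (y : ℂ)) 1 p.2 := ofRealCLM.hasDerivAt
  have := (h2.mul h1.hasDerivAt).deriv
  exact this.trans (by simp [xmul, dx])

theorem dt_xmul (f : ℝ × ℝ → ℂ) : dt (xmul f) = xmul (dt f) := by
  funext p
  exact deriv_const_mul_field (x := p.1) (v := fun s : ℝ => f (s, p.2)) (p.2 : ℂ)

theorem dt_iter_xmul (f : ℝ × ℝ → ℂ) (n : ℕ) : dt^[n] (xmul f) = xmul (dt^[n] f) := by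
  induction n with
  | zero => rfl
  | succ n ih => simp only [Function.iterate_succ_apply', ih, dt_xmul]

theorem isSchwartz_dt_iter {f : ℝ × ℝ → ℂ} (hf : IsSchwartz f) (n : ℕ) :
    IsSchwartz (dt^[n] f) := by
  induction n with
  | zero => exact hf
  | succ n ih => rw [Function.iterate_succ_apply']; exact ih.dt

theorem decays_dt_dx {f : ℝ × ℝ → ℂ} (hf : IsSchwartz f) (α β : ℕ) :
    Decays (dt^[α] (dx^[β] f)) := hf.decay α β

theorem isSchwartz_xmul {f : ℝ × ℝ → ℂ} (hf : IsSchwartz f) : IsSchwartz (xmul f) where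
  smooth := smooth_xmul hf.smooth
  periodic t x := by simp only [xmul, hf.periodic]
  decay α β := by
    change Decays _
    induction β generalizing f with
    | zero =>
      rw [Function.iterate_zero, id, dt_iter_xmul]
      exact (decays_dt_dx hf α 0).xmul
    | succ n ih =>
      rw [Function.iterate_succ_apply, dx_xmul hf.smooth,
        dx_iter_add hf.smooth (smooth_xmul (smooth_dx hf.smooth)),
        dt_iter_add (smooth_dx_iter hf.smooth n)
          (smooth_dx_iter (smooth_xmul (smooth_dx hf.smooth)) n)]
      exact (decays_dt_dx hf α n).add (ih hf.dx)

theorem decays_bound {f : ℝ × ℝ → ℂ} (hf : Decays f) :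
    ∃ C : ℝ, ∀ t x : ℝ, ‖f (t, x)‖ ≤ C * (1 + x ^ 2)⁻¹ := by
  obtain ⟨C, hC⟩ := hf 0
  obtain ⟨D, hD⟩ := hf 2
  refine ⟨C + D, fun t x => ?_⟩
  have h1 := hC (t, x)
  have h2 := hD (t, x)
  simp only [pow_zero, one_mul, sq_abs] at h1 h2
  rw [← div_eq_mul_inv, le_div_iff₀ (by positivity)]
  linarith

theorem slice_continuous {f : ℝ × ℝ → ℂ} (hf : IsSchwartz f) (t : ℝ) :
    Continuous fun x : ℝ => f (t, x) :=
  hf.smooth.continuous.comp (by fun_prop)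

theorem slice_integrable {f : ℝ × ℝ → ℂ} (hf : IsSchwartz f) (t : ℝ) :
    Integrable fun x : ℝ => f (t, x) := by
  obtain ⟨C, hC⟩ := decays_bound (decays_dt_dx hf 0 0)
  exact (integrable_inv_one_add_sq.const_mul C).mono'
    (slice_continuous hf t).aestronglyMeasurable (.of_forall fun x => hC t x)

/-! ### The partial Fourier transform on the Schwartz space -/

/-- The partial Fourier transform in the second variable. -/
def pF (f : ℝ × ℝ → ℂ) : ℝ × ℝ → ℂ := fun p => 𝓕 (fun x : ℝ => f (p.1, x)) p.2

theorem pF_eq (f : ℝ × ℝ → ℂ) (p : ℝ × ℝ) :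
    pF f p = ∫ x : ℝ, cexp (((-2 * Real.pi * x * p.2 : ℝ) : ℂ) * I) * f (p.1, x) := by
  rw [pF, Real.fourier_real_eq_integral_exp_smul]; rfl

theorem pF_norm_le (f : ℝ × ℝ → ℂ) (p : ℝ × ℝ) : ‖pF f p‖ ≤ ∫ x : ℝ, ‖f (p.1, x)‖ := by
  rw [pF_eq]
  refine (norm_integral_le_integral_norm _).trans (le_of_eq ?_)
  congr 1; funext x
  rw [norm_mul, norm_exp_ofReal_mul_I, one_mul]

theorem pF_norm_le_of_bound {f : ℝ × ℝ → ℂ} (hf : IsSchwartz f) {C : ℝ}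
    (hC : ∀ t x : ℝ, ‖f (t, x)‖ ≤ C * (1 + x ^ 2)⁻¹) (p : ℝ × ℝ) :
    ‖pF f p‖ ≤ C * Real.pi := by
  refine (pF_norm_le f p).trans ?_
  rw [← integral_univ_inv_one_add_sq, ← integral_const_mul]
  exact integral_mono (slice_integrable hf _).norm
    (integrable_inv_one_add_sq.const_mul C) (fun x => hC _ x)

theorem pF_smul (a : ℂ) (f : ℝ × ℝ → ℂ) : pF (a • f) = a • pF f := by
  funext p
  simp only [pF_eq, Pi.smul_apply, smul_eq_mul, ← integral_const_mul]
  congr 1; funext x; ring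

theorem pF_add {f g : ℝ × ℝ → ℂ} (hf : IsSchwartz f) (hg : IsSchwartz g) :
    pF (f + g) = pF f + pF g := by
  funext p
  have e (h : ℝ × ℝ → ℂ) (hh : IsSchwartz h) : Integrable fun x : ℝ =>
      cexp (((-2 * Real.pi * x * p.2 : ℝ) : ℂ) * I) * h (p.1, x) := by
    refine (slice_integrable hh p.1).bdd_mul (c := 1) ?_ (.of_forall fun x => ?_)
    · exact Continuous.aestronglyMeasurable (by fun_prop)
    · rw [norm_exp_ofReal_mul_I]
  rw [Pi.add_apply, pF_eq, pF_eq, pF_eq, ← integral_add (e f hf) (e g hg)]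
  congr 1; funext x; simp [mul_add]

theorem pF_mul (c : SmoothCircleFun) (f : ℝ × ℝ → ℂ) :
    pF (fun p => c p.1 * f p) = fun p => c p.1 * pF f p := by
  funext p
  simp only [pF_eq, ← integral_const_mul]
  congr 1; funext x; ring

theorem pF_dx {f : ℝ × ℝ → ℂ} (hf : IsSchwartz f) :
    pF (dx f) = (2 * Real.pi * I : ℂ) • xmul (pF f) := by
  funext p
  have h := Real.fourier_deriv (slice_integrable hf p.1)
    ((hf.smooth.comp (contDiff_const.prodMk contDiff_id)).differentiable (by simp))
    (slice_integrable hf.dx p.1)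
  have := congrFun h p.2
  simp only [pF, xmul, Pi.smul_apply, smul_eq_mul] at this ⊢
  rw [← mul_assoc]
  exact this

/-- Differentiation under the integral sign, dominated by a multiple of `(1 + x²)⁻¹`. Both partial
derivatives are again transforms of Schwartz functions, which is what lets smoothness bootstrap. -/
theorem hasFDerivAt_pF {f : ℝ × ℝ → ℂ} (hf : IsSchwartz f) (p : ℝ × ℝ) :
    HasFDerivAt (pF f) ((ContinuousLinearMap.fst ℝ ℝ ℝ).smulRight (pF (dt f) p) +
      (ContinuousLinearMap.snd ℝ ℝ ℝ).smulRight (pF ((-2 * Real.pi * I : ℂ) • xmul f) p)) p := by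
  set g : ℝ × ℝ → ℂ := (-2 * Real.pi * I : ℂ) • xmul f with hg
  have hgS : IsSchwartz g := (isSchwartz_xmul hf).smul _
  obtain ⟨C, hC⟩ := decays_bound (decays_dt_dx hf.dt 0 0)
  obtain ⟨D, hD⟩ := decays_bound (decays_dt_dx hgS 0 0)
  let e : ℝ × ℝ → ℝ → ℂ := fun q x => cexp (((-2 * Real.pi * x * q.2 : ℝ) : ℂ) * I)
  have he : ∀ q x, ‖e q x‖ = 1 := fun q x => norm_exp_ofReal_mul_I _
  have hec : ∀ q, Continuous (e q) := fun q => by fun_prop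
  let F' : ℝ × ℝ → ℝ → (ℝ × ℝ →L[ℝ] ℂ) := fun q x =>
    (ContinuousLinearMap.fst ℝ ℝ ℝ).smulRight (e q x * dt f (q.1, x)) +
      (ContinuousLinearMap.snd ℝ ℝ ℝ).smulRight (e q x * g (q.1, x))
  have hdiff : ∀ q x, HasFDerivAt (fun q : ℝ × ℝ => e q x * f (q.1, x)) (F' q x) q := by
    intro q x
    have h1 : HasFDerivAt (fun q : ℝ × ℝ => f (q.1, x))
        ((fderiv ℝ f (q.1, x)).comp ((ContinuousLinearMap.fst ℝ ℝ ℝ).prod 0)) q :=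
      HasFDerivAt.comp q (hf.smooth.differentiable (by simp) (q.1, x)).hasFDerivAt
        (hasFDerivAt_fst.prodMk (hasFDerivAt_const x q))
    have h2 : HasFDerivAt (fun q : ℝ × ℝ => ((-2 * Real.pi * x * q.2 : ℝ) : ℂ) * I)
        ((ContinuousLinearMap.snd ℝ ℝ ℝ).smulRight (((-2 * Real.pi * x : ℝ) : ℂ) * I)) q := by
      have := ((ContinuousLinearMap.snd ℝ ℝ ℝ).smulRight
        (((-2 * Real.pi * x : ℝ) : ℂ) * I)).hasFDerivAt (x := q)
      refine this.congr_of_eventuallyEq (.of_forall fun r => ?_)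
      simp; ring
    refine (h2.cexp.mul h1).congr_fderiv ?_
    have hdtf := congrFun (dt_eq hf.smooth) (q.1, x)
    ext
    · simp [F', hdtf, e]
    · simp [F', g, xmul, e, show ((0 : ℝ), (0 : ℝ)) = 0 from rfl]; ring
  have hFint : ∀ (h : ℝ × ℝ → ℂ), IsSchwartz h → Integrable fun x : ℝ => e p x * h (p.1, x) := by
    intro h hh
    exact (slice_integrable hh p.1).bdd_mul (c := 1) (hec p).aestronglyMeasurable
      (.of_forall fun x => (he p x).le)
  have hF'c : Continuous (F' p) := by
    have h1 := slice_continuous hf.dt p.1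
    have h2 := slice_continuous hgS p.1
    have h3 := hec p
    exact ((ContinuousLinearMap.smulRightL ℝ (ℝ × ℝ) ℂ _).continuous.comp (h3.mul h1)).add
      ((ContinuousLinearMap.smulRightL ℝ (ℝ × ℝ) ℂ _).continuous.comp (h3.mul h2))
  have hb : ∀ q x, ‖F' q x‖ ≤ (C + D) * (1 + x ^ 2)⁻¹ := by
    intro q x
    refine (norm_add_le _ _).trans ?_
    rw [add_mul]
    refine add_le_add ?_ ?_
    · refine (ContinuousLinearMap.norm_smulRight_apply _ _).le.trans ?_
      rw [norm_mul, he, one_mul]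
      exact (mul_le_of_le_one_left (norm_nonneg _)
        (ContinuousLinearMap.norm_fst_le ..)).trans (hC q.1 x)
    · refine (ContinuousLinearMap.norm_smulRight_apply _ _).le.trans ?_
      rw [norm_mul, he, one_mul]
      exact (mul_le_of_le_one_left (norm_nonneg _)
        (ContinuousLinearMap.norm_snd_le ..)).trans (hD q.1 x)
  have key := hasFDerivAt_integral_of_dominated_of_fderiv_le (𝕜 := ℝ) (μ := volume)
    (F := fun q x => e q x * f (q.1, x)) (F' := F') (x₀ := p)
    (bound := fun x => (C + D) * (1 + x ^ 2)⁻¹) (s := Set.univ) Filter.univ_mem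
    (.of_forall fun q => ((hec q).mul (slice_continuous hf q.1)).aestronglyMeasurable)
    (hFint f hf) hF'c.aestronglyMeasurable (.of_forall fun x q _ => hb q x)
    (integrable_inv_one_add_sq.const_mul _) (.of_forall fun x q _ => hdiff q x)
  have hpF : pF f = fun q => ∫ x, e q x * f (q.1, x) := funext fun q => pF_eq f q
  rw [hpF]
  refine key.congr_fderiv ?_
  have hint : Integrable (F' p) :=
    (integrable_inv_one_add_sq.const_mul (C + D)).mono' hF'c.aestronglyMeasurable
      (.of_forall fun x => hb p x)
  ext
  · rw [ContinuousLinearMap.comp_apply, ContinuousLinearMap.integral_apply hint]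
    simp [F', pF_eq, e]
  · rw [ContinuousLinearMap.comp_apply, ContinuousLinearMap.integral_apply hint]
    simp [F', pF_eq, e]

theorem smooth_pF {f : ℝ × ℝ → ℂ} (hf : IsSchwartz f) : ContDiff ℝ ∞ (pF f) := by
  have : ∀ n : ℕ, ∀ f, IsSchwartz f → ContDiff ℝ n (pF f) := by
    intro n
    induction n with
    | zero =>
      intro f hf
      exact contDiff_zero.2 (continuous_iff_continuousAt.2
        fun p => (hasFDerivAt_pF hf p).continuousAt)
    | succ n ih =>
      intro f hf
      refine contDiff_succ_iff_hasFDerivAt.2 ⟨_, ?_, hasFDerivAt_pF hf⟩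
      exact (contDiff_const.smulRight (ih _ hf.dt)).add
        (contDiff_const.smulRight (ih _ ((isSchwartz_xmul hf).smul _)))
  exact contDiff_infty.2 fun n => this n f hf

theorem dt_pF {f : ℝ × ℝ → ℂ} (hf : IsSchwartz f) : dt (pF f) = pF (dt f) := by
  rw [dt_eq (smooth_pF hf)]
  funext p
  rw [(hasFDerivAt_pF hf p).fderiv]
  simp

theorem dx_pF {f : ℝ × ℝ → ℂ} (hf : IsSchwartz f) :
    dx (pF f) = pF ((-2 * Real.pi * I : ℂ) • xmul f) := by
  rw [dx_eq (smooth_pF hf)]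
  funext p
  rw [(hasFDerivAt_pF hf p).fderiv]
  simp

/-- Multiplication by `-2πi x`. -/
def xm (f : ℝ × ℝ → ℂ) : ℝ × ℝ → ℂ := (-2 * Real.pi * I : ℂ) • xmul f

theorem isSchwartz_xm {f : ℝ × ℝ → ℂ} (hf : IsSchwartz f) : IsSchwartz (xm f) :=
  (isSchwartz_xmul hf).smul _

theorem isSchwartz_xm_iter {f : ℝ × ℝ → ℂ} (hf : IsSchwartz f) (n : ℕ) :
    IsSchwartz (xm^[n] f) := by
  induction n with
  | zero => exact hf
  | succ n ih => rw [Function.iterate_succ_apply']; exact isSchwartz_xm ih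

theorem dt_iter_pF {f : ℝ × ℝ → ℂ} (hf : IsSchwartz f) (n : ℕ) :
    dt^[n] (pF f) = pF (dt^[n] f) := by
  induction n with
  | zero => rfl
  | succ n ih =>
    simp only [Function.iterate_succ_apply', ih, dt_pF (isSchwartz_dt_iter hf n)]

theorem dx_iter_pF {f : ℝ × ℝ → ℂ} (hf : IsSchwartz f) (n : ℕ) :
    dx^[n] (pF f) = pF (xm^[n] f) := by
  induction n with
  | zero => rfl
  | succ n ih =>
    simp only [Function.iterate_succ_apply', ih, dx_pF (isSchwartz_xm_iter hf n)]
    rfl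

theorem pow_mul_pF {f : ℝ × ℝ → ℂ} (hf : IsSchwartz f) (γ : ℕ) (p : ℝ × ℝ) :
    |p.2| ^ γ * ‖pF f p‖ = ((2 * Real.pi) ^ γ)⁻¹ * ‖pF (dx^[γ] f) p‖ := by
  induction γ with
  | zero => simp
  | succ n ih =>
    rw [Function.iterate_succ_apply', pF_dx (hf.dx_iter n)]
    simp only [Pi.smul_apply, xmul, smul_eq_mul, norm_mul, norm_real, norm_I, Complex.norm_ofNat,
      Real.norm_eq_abs, abs_of_pos Real.pi_pos]
    rw [pow_succ, mul_right_comm, ih]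
    field_simp
    ring

theorem isSchwartz_pF {f : ℝ × ℝ → ℂ} (hf : IsSchwartz f) : IsSchwartz (pF f) where
  smooth := smooth_pF hf
  periodic t x := by simp only [pF, hf.periodic]
  decay α β γ := by
    have h1 := isSchwartz_dt_iter (isSchwartz_xm_iter hf β) α
    rw [dx_iter_pF hf, dt_iter_pF (isSchwartz_xm_iter hf β)]
    obtain ⟨C, hC⟩ := decays_bound (decays_dt_dx h1 0 γ)
    refine ⟨((2 * Real.pi) ^ γ)⁻¹ * (C * Real.pi), fun p => ?_⟩
    rw [pow_mul_pF h1]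
    exact mul_le_mul_of_nonneg_left (pF_norm_le_of_bound (h1.dx_iter γ) hC p) (by positivity)

/-- Reflection in the second variable. -/
def refl (f : ℝ × ℝ → ℂ) : ℝ × ℝ → ℂ := fun p => f (p.1, -p.2)

theorem dt_refl (f : ℝ × ℝ → ℂ) : dt (refl f) = refl (dt f) := rfl

theorem dx_refl (f : ℝ × ℝ → ℂ) : dx (refl f) = (-1 : ℂ) • refl (dx f) := by
  funext p
  simpa [dx, refl] using deriv_comp_neg (fun y : ℝ => f (p.1, y)) p.2

theorem dt_iter_refl (f : ℝ × ℝ → ℂ) (n : ℕ) : dt^[n] (refl f) = refl (dt^[n] f) := by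
  induction n with
  | zero => rfl
  | succ n ih => simp only [Function.iterate_succ_apply', ih, dt_refl]

theorem dx_iter_refl (f : ℝ × ℝ → ℂ) (n : ℕ) :
    dx^[n] (refl f) = ((-1 : ℂ) ^ n) • refl (dx^[n] f) := by
  induction n with
  | zero => simp
  | succ n ih =>
    simp only [Function.iterate_succ_apply', ih, dx_smul, dx_refl, smul_smul, pow_succ]

theorem isSchwartz_refl {f : ℝ × ℝ → ℂ} (hf : IsSchwartz f) : IsSchwartz (refl f) where
  smooth := hf.smooth.comp (contDiff_fst.prodMk contDiff_snd.neg)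
  periodic t x := hf.periodic t (-x)
  decay α β γ := by
    obtain ⟨C, hC⟩ := hf.decay α β γ
    refine ⟨C, fun p => ?_⟩
    rw [dx_iter_refl, dt_iter_smul, dt_iter_refl]
    simpa [refl, norm_smul] using hC (p.1, -p.2)

/-- The inverse of the partial Fourier transform. -/
def pFinv (f : ℝ × ℝ → ℂ) : ℝ × ℝ → ℂ := refl (pF f)

theorem isSchwartz_pFinv {f : ℝ × ℝ → ℂ} (hf : IsSchwartz f) : IsSchwartz (pFinv f) :=
  isSchwartz_refl (isSchwartz_pF hf)

theorem pFinv_eq (f : ℝ × ℝ → ℂ) (p : ℝ × ℝ) :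
    pFinv f p = 𝓕⁻ (fun x : ℝ => f (p.1, x)) p.2 := by
  rw [Real.fourierInv_eq_fourier_neg]; rfl

theorem pF_pFinv {f : ℝ × ℝ → ℂ} (hf : IsSchwartz f) : pF (pFinv f) = f := by
  funext p
  have h := Continuous.fourier_fourierInv_eq (slice_continuous hf p.1) (slice_integrable hf p.1)
    (slice_integrable (isSchwartz_pF hf) p.1)
  simp only [pF, pFinv_eq]
  exact congrFun h p.2

theorem pFinv_pF {f : ℝ × ℝ → ℂ} (hf : IsSchwartz f) : pFinv (pF f) = f := by
  funext p
  have h := Continuous.fourierInv_fourier_eq (slice_continuous hf p.1) (slice_integrable hf p.1)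
    (slice_integrable (isSchwartz_pF hf) p.1)
  rw [pFinv_eq]
  exact congrFun h p.2

/-! ### The conjugated operator -/

/-- The conjugate of `L` by the partial Fourier transform. -/
def symP (c q : ℝ → ℂ) (U : ℝ × ℝ → ℂ) : ℝ × ℝ → ℂ := fun p =>
  dt U p + (2 * Real.pi * I * p.2 * c p.1 + q p.1) * U p

theorem pF_opL (c q : SmoothCircleFun) (u : SchwartzTR) :
    pF (opL c q u : ℝ × ℝ → ℂ) = symP c q (pF u) := by
  have hu : IsSchwartz (u : ℝ × ℝ → ℂ) := u.2
  have e : (opL c q u : ℝ × ℝ → ℂ) =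
    (dt u + fun p => c p.1 * dx u p) + fun p => q p.1 * (u : ℝ × ℝ → ℂ) p := rfl
  rw [e, pF_add (hu.dt.add (hu.dx.mul c)) (hu.mul q), pF_add hu.dt (hu.dx.mul c),
    pF_mul, pF_mul, pF_dx hu, dt_pF hu |>.symm]
  funext p
  simp [symP, xmul]
  ring

theorem opL_eq_of_symP (c q : SmoothCircleFun) {U : ℝ × ℝ → ℂ} (hU : IsSchwartz U)
    (f : SchwartzTR) (h : symP c q U = pF f) :
    opL c q ⟨pFinv U, isSchwartz_pFinv hU⟩ = f := by
  have h1 := pF_opL c q ⟨pFinv U, isSchwartz_pFinv hU⟩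
  rw [pF_pFinv hU, h] at h1
  have h2 := congrArg pFinv h1
  exact Subtype.ext ((pFinv_pF (opL c q _).2).symm.trans (h2.trans (pFinv_pF f.2)))

/-! ### Smooth dependence on parameters, primitives in `t`, and the phase -/

theorem hasFDerivAt_integral_param {V : Type} [NormedAddCommGroup V] [NormedSpace ℝ V]
    [CompleteSpace V] {F : (ℝ × ℝ) × ℝ → V} (hF : ContDiff ℝ 1 F) (x : ℝ × ℝ) :
    HasFDerivAt (fun x => ∫ s in (0 : ℝ)..1, F (x, s))
      (∫ s in (0 : ℝ)..1, (fderiv ℝ F (x, s)).comp (ContinuousLinearMap.inl ℝ (ℝ × ℝ) ℝ)) x := by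
  have hF' : Continuous fun y => (fderiv ℝ F y).comp (ContinuousLinearMap.inl ℝ (ℝ × ℝ) ℝ) :=
    (hF.continuous_fderiv (by simp)).clm_comp continuous_const
  obtain ⟨C, hC⟩ := ((isCompact_closedBall x 1).prod
    (isCompact_Icc (a := (0 : ℝ)) (b := 1))).exists_bound_of_continuousOn hF'.continuousOn
  refine intervalIntegral.hasFDerivAt_integral_of_dominated_of_fderiv_le (𝕜 := ℝ)
    (F := fun x s => F (x, s))
    (F' := fun x s => (fderiv ℝ F (x, s)).comp (ContinuousLinearMap.inl ℝ (ℝ × ℝ) ℝ))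
    (bound := fun _ => C) (Metric.ball_mem_nhds x one_pos) (.of_forall fun y => ?_) ?_ ?_
    (.of_forall fun s hs y hy => ?_) ?_ (.of_forall fun s hs y hy => ?_)
  · exact (hF.continuous.comp (by fun_prop)).aestronglyMeasurable
  · exact (hF.continuous.comp (by fun_prop)).intervalIntegrable _ _
  · exact (hF'.comp (by fun_prop : Continuous fun s : ℝ => (x, s))).aestronglyMeasurable
  · rw [Set.uIoc_of_le zero_le_one] at hs
    exact hC (y, s) ⟨Metric.ball_subset_closedBall hy, hs.1.le, hs.2⟩
  · exact intervalIntegrable_const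
  · exact HasFDerivAt.comp y (hF.differentiable (by simp) (y, s)).hasFDerivAt
      (hasFDerivAt_prodMk_left y s)

/-- The target space varies in the induction, since the derivative of the integral is an integral of
maps valued in a space of linear maps. -/
theorem contDiff_integral_param (n : ℕ) : ∀ {V : Type} [NormedAddCommGroup V] [NormedSpace ℝ V]
    [CompleteSpace V] {F : (ℝ × ℝ) × ℝ → V}, ContDiff ℝ ∞ F →
    ContDiff ℝ n (fun x => ∫ s in (0 : ℝ)..1, F (x, s)) := by
  induction n with
  | zero =>
    intro V _ _ _ F hF
    exact contDiff_zero.2 (continuous_iff_continuousAt.2 fun x =>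
      (hasFDerivAt_integral_param (hF.of_le (by simp)) x).continuousAt)
  | succ n ih =>
    intro V _ _ _ F hF
    exact contDiff_succ_iff_hasFDerivAt.2 ⟨_, ih
      (F := fun y => (fderiv ℝ F y).comp (ContinuousLinearMap.inl ℝ (ℝ × ℝ) ℝ))
      ((hF.fderiv_right (m := ∞) (by simp)).clm_comp contDiff_const),
      hasFDerivAt_integral_param (hF.of_le (by simp))⟩

theorem smooth_integral_zero_one {F : (ℝ × ℝ) × ℝ → ℂ} (hF : ContDiff ℝ ∞ F) :
    ContDiff ℝ ∞ (fun x => ∫ s in (0 : ℝ)..1, F (x, s)) :=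
  contDiff_infty.2 fun n => contDiff_integral_param n hF

/-- The primitive `∫₀ᵗ G(s, x) ds`. -/
def primT (G : ℝ × ℝ → ℂ) : ℝ × ℝ → ℂ := fun p => ∫ s in (0 : ℝ)..p.1, G (s, p.2)

theorem smooth_primT {G : ℝ × ℝ → ℂ} (hG : ContDiff ℝ ∞ G) : ContDiff ℝ ∞ (primT G) := by
  -- Rescaling fixes the endpoints, so that only the integrand depends on the parameters.
  have h : primT G = fun p => (p.1 : ℂ) * ∫ s in (0 : ℝ)..1, G (p.1 * s, p.2) := by
    funext p
    have := intervalIntegral.smul_integral_comp_mul_left (a := 0) (b := 1)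
      (f := fun s => G (s, p.2)) p.1
    rw [mul_zero, mul_one] at this
    exact this.symm.trans (Complex.real_smul)
  rw [h]
  refine (ofRealCLM.contDiff.comp contDiff_fst).mul (smooth_integral_zero_one
    (F := fun y => G (y.1.1 * y.2, y.1.2)) (hG.comp ?_))
  fun_prop

theorem hasDerivAt_primT {G : ℝ × ℝ → ℂ} (hG : ContDiff ℝ ∞ G) (t x : ℝ) :
    HasDerivAt (fun s => primT G (s, x)) (G (t, x)) t :=
  intervalIntegral.integral_hasDerivAt_right
    ((hG.continuous.comp (by fun_prop : Continuous fun s : ℝ => (s, x))).intervalIntegrable _ _)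
    ((hG.continuous.comp
      (by fun_prop : Continuous fun s : ℝ => (s, x))).stronglyMeasurableAtFilter _ _)
    (hG.continuous.comp (by fun_prop : Continuous fun s : ℝ => (s, x))).continuousAt

/-- The primitive `∫₀ᵗ c`. -/
def prim (c : ℝ → ℂ) (t : ℝ) : ℂ := ∫ s in (0 : ℝ)..t, c s

theorem hasDerivAt_prim {c : ℝ → ℂ} (hc : Continuous c) (t : ℝ) :
    HasDerivAt (prim c) (c t) t :=
  intervalIntegral.integral_hasDerivAt_right (hc.intervalIntegrable _ _)
    (hc.stronglyMeasurableAtFilter _ _) hc.continuousAt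

theorem smooth_prim (c : SmoothCircleFun) : ContDiff ℝ ∞ (prim c) := by
  refine contDiff_infty_iff_deriv.2 ⟨fun t =>
    (hasDerivAt_prim c.smooth.continuous t).differentiableAt, ?_⟩
  have : deriv (prim c) = c := funext fun t => (hasDerivAt_prim c.smooth.continuous t).deriv
  rw [this]; exact c.smooth

theorem two_pi_mul_mean (c : SmoothCircleFun) :
    prim c (2 * Real.pi) = 2 * Real.pi * mean c := by
  have : (Real.pi : ℂ) ≠ 0 := by exact_mod_cast Real.pi_ne_zero
  rw [mean, prim]; field_simp

theorem prim_add (c : SmoothCircleFun) (t : ℝ) :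
    prim c (t + 2 * Real.pi) = prim c t + prim c (2 * Real.pi) := by
  have hi := fun a b => c.smooth.continuous.intervalIntegrable (μ := volume) a b
  have h := c.periodic.intervalIntegral_add_eq t 0
  rw [zero_add] at h
  rw [prim, ← intervalIntegral.integral_add_adjacent_intervals (hi 0 t) (hi t _), h]
  rfl

/-- The phase `2πi x ∫₀ᵗ c + ∫₀ᵗ q`. -/
def phase (c q : ℝ → ℂ) (p : ℝ × ℝ) : ℂ := 2 * Real.pi * I * p.2 * prim c p.1 + prim q p.1

theorem smooth_phase (c q : SmoothCircleFun) : ContDiff ℝ ∞ (phase c q) := by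
  have h1 := (smooth_prim c).comp (contDiff_fst (𝕜 := ℝ) (E := ℝ) (F := ℝ) (n := ∞))
  have h2 := (smooth_prim q).comp (contDiff_fst (𝕜 := ℝ) (E := ℝ) (F := ℝ) (n := ∞))
  have h3 := ofRealCLM.contDiff.comp (contDiff_snd (𝕜 := ℝ) (E := ℝ) (F := ℝ) (n := ∞))
  exact ((contDiff_const.mul h3).mul h1).add h2

theorem hasDerivAt_phase (c q : SmoothCircleFun) (t x : ℝ) :
    HasDerivAt (fun s => phase c q (s, x)) (2 * Real.pi * I * x * c t + q t) t :=
  ((hasDerivAt_prim c.smooth.continuous t).const_mul (2 * Real.pi * I * x)).fun_add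
    (hasDerivAt_prim q.smooth.continuous t)

theorem phase_add (c q : SmoothCircleFun) (t x : ℝ) :
    phase c q (t + 2 * Real.pi, x) = phase c q (t, x) + phase c q (2 * Real.pi, x) := by
  simp only [phase, prim_add]; ring

/-! ### The scalar equation: bound and explicit solution -/

/-- A priori bound for the scalar equation `w' + p w = h`. -/
theorem ode_bound {w h p Φ : ℝ → ℂ} (hw : ∀ t, HasDerivAt w (h t - p t * w t) t)
    (hh : Continuous h) (hΦ : ∀ t, HasDerivAt Φ (p t) t) {M K s t : ℝ}
    (hM : ∀ r, ‖h r‖ ≤ M) (hst : |t - s| ≤ 2 * Real.pi)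
    (hK : ∀ r ∈ Set.uIcc s t, ‖cexp (Φ r - Φ t)‖ ≤ K) :
    ‖w t‖ ≤ ‖cexp (Φ s - Φ t)‖ * ‖w s‖ + 2 * Real.pi * K * M := by
  have hΦc : Continuous Φ := continuous_iff_continuousAt.2 fun r => (hΦ r).continuousAt
  -- Integrating factor normalised to be `1` at the endpoint `t`. The starting point `s` may lie on
  -- either side of `t`.
  have hd : ∀ r, HasDerivAt (fun r => cexp (Φ r - Φ t) * w r) (cexp (Φ r - Φ t) * h r) r := by
    intro r
    refine (((hΦ r).sub_const (Φ t)).cexp.mul (hw r)).congr_deriv ?_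
    ring
  have hi := intervalIntegral.integral_eq_sub_of_hasDerivAt (a := s) (b := t)
    (fun r _ => hd r) ((Continuous.mul (by fun_prop) hh).intervalIntegrable _ _)
  rw [sub_self, Complex.exp_zero, one_mul] at hi
  have hb : ‖∫ r in s..t, cexp (Φ r - Φ t) * h r‖ ≤ K * M * |t - s| := by
    refine intervalIntegral.norm_integral_le_of_norm_le_const fun r hr => ?_
    have hr' := Set.uIoc_subset_uIcc hr
    rw [norm_mul]
    exact mul_le_mul (hK r hr') (hM r) (norm_nonneg _) ((norm_nonneg _).trans (hK r hr'))
  have hK0 : 0 ≤ K := (norm_nonneg _).trans (hK s Set.left_mem_uIcc)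
  have hM0 : 0 ≤ M := (norm_nonneg _).trans (hM 0)
  have hwt : w t = cexp (Φ s - Φ t) * w s + ∫ r in s..t, cexp (Φ r - Φ t) * h r := by
    rw [hi]; ring
  rw [hwt]
  refine (norm_add_le _ _).trans (add_le_add (norm_mul _ _).le (hb.trans ?_))
  calc K * M * |t - s| ≤ K * M * (2 * Real.pi) := by gcongr
    _ = _ := by ring

/-- The solution `e^{-Φ} (∫₀ᵗ e^Φ F + κ)` of `symP c q U = F`. -/
def sol (c q : ℝ → ℂ) (F : ℝ × ℝ → ℂ) (κ : ℝ → ℂ) : ℝ × ℝ → ℂ := fun p =>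
  cexp (-phase c q p) * (primT (fun r => cexp (phase c q r) * F r) p + κ p.2)

theorem smooth_exp_phase_mul (c q : SmoothCircleFun) {F : ℝ × ℝ → ℂ} (hF : ContDiff ℝ ∞ F) :
    ContDiff ℝ ∞ (fun r => cexp (phase c q r) * F r) :=
  (smooth_phase c q).cexp.mul hF

theorem smooth_sol (c q : SmoothCircleFun) {F : ℝ × ℝ → ℂ} (hF : ContDiff ℝ ∞ F) {κ : ℝ → ℂ}
    (hκ : ContDiff ℝ ∞ κ) : ContDiff ℝ ∞ (sol c q F κ) :=
  (smooth_phase c q).neg.cexp.mul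
    ((smooth_primT (smooth_exp_phase_mul c q hF)).add (hκ.comp contDiff_snd))

theorem symP_sol (c q : SmoothCircleFun) {F : ℝ × ℝ → ℂ} (hF : ContDiff ℝ ∞ F) (κ : ℝ → ℂ) :
    symP c q (sol c q F κ) = F := by
  funext p
  have h := ((hasDerivAt_phase c q p.1 p.2).neg.cexp.mul
    ((hasDerivAt_primT (smooth_exp_phase_mul c q hF) p.1 p.2).add_const (κ p.2))).deriv
  have h' : dt (sol c q F κ) p = _ := h
  have e : cexp (-phase c q p) * cexp (phase c q p) = 1 := by
    rw [← Complex.exp_add, neg_add_cancel, Complex.exp_zero]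
  simp only [symP, h', sol]
  simp only [Pi.neg_apply, Prod.mk.eta]
  linear_combination (F p) * e

/-- A shift of `t` by `2π` multiplies `e^Φ` by `e^{Φ(2π,x)}`; the hypothesis on `κ` is exactly what
makes the shifted bracket this factor times the original one. -/
theorem sol_periodic (c q : SmoothCircleFun) {F : ℝ × ℝ → ℂ} (hF : ContDiff ℝ ∞ F)
    (hper : ∀ t x, F (t + 2 * Real.pi, x) = F (t, x)) {κ : ℝ → ℂ}
    (hκ : ∀ x, primT (fun r => cexp (phase c q r) * F r) (2 * Real.pi, x) =
      (cexp (phase c q (2 * Real.pi, x)) - 1) * κ x) (t x : ℝ) :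
    sol c q F κ (t + 2 * Real.pi, x) = sol c q F κ (t, x) := by
  set G : ℝ × ℝ → ℂ := fun r => cexp (phase c q r) * F r with hG
  have hGc : Continuous fun s => G (s, x) :=
    (smooth_exp_phase_mul c q hF).continuous.comp (by fun_prop)
  have hI : primT G (t + 2 * Real.pi, x) =
      primT G (2 * Real.pi, x) + cexp (phase c q (2 * Real.pi, x)) * primT G (t, x) := by
    have h1 : ∫ s in (0 : ℝ)..t, G (s + 2 * Real.pi, x) =
        cexp (phase c q (2 * Real.pi, x)) * primT G (t, x) := by
      rw [primT, ← intervalIntegral.integral_const_mul]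
      refine intervalIntegral.integral_congr fun s _ => ?_
      simp only [hG, hper, phase_add, Complex.exp_add]; ring
    rw [← h1, intervalIntegral.integral_comp_add_right (fun s => G (s, x)), zero_add]
    exact (intervalIntegral.integral_add_adjacent_intervals (hGc.intervalIntegrable _ _)
      (hGc.intervalIntegrable _ _)).symm
  simp only [sol]
  rw [← hG, hI, hκ, phase_add, neg_add, Complex.exp_add]
  have e : cexp (-phase c q (2 * Real.pi, x)) * cexp (phase c q (2 * Real.pi, x)) = 1 := by
    rw [← Complex.exp_add, neg_add_cancel, Complex.exp_zero]
  linear_combination (cexp (-phase c q (t, x)) * (κ x + primT G (t, x))) * e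

/-! ### From a priori bounds to Schwartz regularity -/

/-- `2π`-periodicity in the first variable. -/
def PeriodicT (f : ℝ × ℝ → ℂ) : Prop := ∀ t x, f (t + 2 * Real.pi, x) = f (t, x)

theorem PeriodicT.dx {f : ℝ × ℝ → ℂ} (hf : PeriodicT f) : PeriodicT (dx f) := by
  intro t x
  exact congrArg (fun g : ℝ → ℂ => deriv g x) (funext fun y => hf t y)

theorem PeriodicT.dx_iter {f : ℝ × ℝ → ℂ} (hf : PeriodicT f) (n : ℕ) :
    PeriodicT (TorusLine.dx^[n] f) := by
  induction n with
  | zero => exact hf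
  | succ n ih => rw [Function.iterate_succ_apply']; exact ih.dx

theorem PeriodicT.exists_mem_Icc {f : ℝ × ℝ → ℂ} (hf : PeriodicT f) (t : ℝ) :
    ∃ s ∈ Set.Icc 0 (2 * Real.pi), ∀ x, f (t, x) = f (s, x) := by
  have h2 : (0 : ℝ) < 2 * Real.pi := by positivity
  refine ⟨toIcoMod h2 0 t, ?_, fun x => ?_⟩
  · have := toIcoMod_mem_Ico h2 0 t
    rw [zero_add] at this
    exact ⟨this.1, this.2.le⟩
  · have hp : Function.Periodic (fun t => f (t, x)) (2 * Real.pi) := fun t => hf t x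
    have h3 := hp.sub_zsmul_eq (x := t) (toIcoDiv h2 0 t)
    exact h3.symm

theorem PeriodicT.bounded {f : ℝ × ℝ → ℂ} (hf : PeriodicT f) (hc : Continuous f) (R : ℝ) :
    ∃ C, ∀ t x, |x| ≤ R → ‖f (t, x)‖ ≤ C := by
  obtain ⟨C, hC⟩ := ((isCompact_Icc (a := (0 : ℝ)) (b := 2 * Real.pi)).prod
    (isCompact_Icc (a := -R) (b := R))).exists_bound_of_continuousOn hc.continuousOn
  refine ⟨C, fun t x hx => ?_⟩
  obtain ⟨s, hs, h⟩ := hf.exists_mem_Icc t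
  rw [h x]
  exact hC (s, x) ⟨hs, abs_le.1 hx⟩

/-- Rapid decay of the first `n` derivatives in `t`. -/
def DecaysT (n : ℕ) (f : ℝ × ℝ → ℂ) : Prop := ∀ j ≤ n, Decays (dt^[j] f)

theorem DecaysT.add {n : ℕ} {f g : ℝ × ℝ → ℂ} (hfs : ContDiff ℝ ∞ f) (hgs : ContDiff ℝ ∞ g)
    (hf : DecaysT n f) (hg : DecaysT n g) : DecaysT n (f + g) := fun j hj => by
  rw [dt_iter_add hfs hgs]; exact (hf j hj).add (hg j hj)

theorem DecaysT.smul {n : ℕ} {f : ℝ × ℝ → ℂ} (a : ℂ) (hf : DecaysT n f) :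
    DecaysT n (a • f) := fun j hj => by
  rw [dt_iter_smul]; exact (hf j hj).mul_of_bounded (a := fun _ => a) fun _ => le_rfl

theorem DecaysT.xmul {n : ℕ} {f : ℝ × ℝ → ℂ} (hf : DecaysT n f) :
    DecaysT n (xmul f) := fun j hj => by
  rw [dt_iter_xmul]; exact (hf j hj).xmul

theorem DecaysT.mul {n : ℕ} : ∀ (c : SmoothCircleFun) {f : ℝ × ℝ → ℂ}, ContDiff ℝ ∞ f →
    DecaysT n f → DecaysT n (fun p => c p.1 * f p) := by
  induction n with
  | zero =>
    intro c f _ hf j hj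
    obtain ⟨A, hA⟩ := c.bounded
    obtain rfl : j = 0 := by omega
    exact (hf 0 le_rfl).mul_of_bounded (a := fun p => c p.1) fun p => hA p.1
  | succ n ih =>
    intro c f hs hf j hj
    have h0 : DecaysT n f := fun i hi => hf i (by omega)
    have h1 : DecaysT n (dt f) := fun i hi => by
      have := hf (i + 1) (by omega)
      rwa [Function.iterate_succ_apply] at this
    rcases j with _ | j
    · exact ih c hs h0 0 (by omega)
    · rw [Function.iterate_succ_apply, dt_mul c hs]
      exact DecaysT.add (c.der.smooth_mul hs) (c.smooth_mul (smooth_dt hs)) (ih c.der hs h0)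
        (ih c (smooth_dt hs) h1) j (by omega)

theorem decaysT_of_isSchwartz {f : ℝ × ℝ → ℂ} (hf : IsSchwartz f) (n : ℕ) : DecaysT n f :=
  fun j _ => decays_dt_dx hf j 0

theorem smooth_smul (a : ℂ) {f : ℝ × ℝ → ℂ} (hf : ContDiff ℝ ∞ f) : ContDiff ℝ ∞ (a • f) :=
  contDiff_const.smul hf

theorem smooth_add {f g : ℝ × ℝ → ℂ} (hf : ContDiff ℝ ∞ f) (hg : ContDiff ℝ ∞ g) :
    ContDiff ℝ ∞ (f + g) :=
  hf.add hg

theorem symP_eq (c q : SmoothCircleFun) (U : ℝ × ℝ → ℂ) :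
    symP c q U = dt U + ((2 * Real.pi * I : ℂ) • xmul (fun p => c p.1 * U p) +
      fun p => q p.1 * U p) := by
  funext p
  simp [symP, xmul]; ring

theorem smooth_symP (c q : SmoothCircleFun) {U : ℝ × ℝ → ℂ} (hU : ContDiff ℝ ∞ U) :
    ContDiff ℝ ∞ (symP c q U) := by
  rw [symP_eq]
  exact (smooth_dt hU).add (smooth_add (smooth_smul _ (smooth_xmul (c.smooth_mul hU))) (q.smooth_mul hU))

theorem dx_symP (c q : SmoothCircleFun) {U : ℝ × ℝ → ℂ} (hU : ContDiff ℝ ∞ U) :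
    dx (symP c q U) = symP c q (dx U) + (2 * Real.pi * I : ℂ) • fun p => c p.1 * U p := by
  rw [symP_eq, symP_eq, dx_add (smooth_dt hU)
    (smooth_add (smooth_smul _ (smooth_xmul (c.smooth_mul hU))) (q.smooth_mul hU)),
    dx_add (smooth_smul _ (smooth_xmul (c.smooth_mul hU))) (q.smooth_mul hU), dx_smul,
    dx_xmul (c.smooth_mul hU), dx_dt_comm hU, dx_mul, dx_mul, smul_add]
  abel

/-- The commutator of `∂_x` with the operator is multiplication by `2πi c(t)`, so the equation for
one `x`-derivative has a source involving only the preceding one. -/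
theorem dx_iter_symP (c q : SmoothCircleFun) {U : ℝ × ℝ → ℂ} (hU : ContDiff ℝ ∞ U) (n : ℕ) :
    dx^[n + 1] (symP c q U) = symP c q (dx^[n + 1] U) +
      ((n + 1 : ℂ) * (2 * Real.pi * I)) • fun p => c p.1 * dx^[n] U p := by
  induction n with
  | zero => simp [dx_symP c q hU]
  | succ n ih =>
    have hn := smooth_dx_iter hU n
    have hn1 := smooth_dx_iter hU (n + 1)
    rw [Function.iterate_succ_apply', ih, dx_add (smooth_symP c q hn1)
      (smooth_smul _ (c.smooth_mul hn)), dx_symP c q hn1, dx_smul, dx_mul,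
      ← Function.iterate_succ_apply' dx, ← Function.iterate_succ_apply' dx]
    funext p
    simp only [Pi.add_apply, Pi.smul_apply, smul_eq_mul]
    push_cast
    ring

/-- A smooth periodic solution of `symP c q U = F` with `F` Schwartz is Schwartz as soon as its
`x`-derivatives satisfy a uniform a priori bound for large `|x|`. -/
theorem isSchwartz_of_apriori (c q : SmoothCircleFun) {U : ℝ × ℝ → ℂ} (hU : ContDiff ℝ ∞ U)
    (hper : PeriodicT U) (hF : IsSchwartz (symP c q U)) (R K : ℝ)
    (hap : ∀ n x, R ≤ |x| → ∀ M, (∀ t, ‖symP c q (dx^[n] U) (t, x)‖ ≤ M) →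
      ∀ t, ‖dx^[n] U (t, x)‖ ≤ K * M) : IsSchwartz U := by
  have step (n : ℕ) (h : Decays (symP c q (dx^[n] U))) : Decays (dx^[n] U) := by
    intro γ
    obtain ⟨C, hC⟩ := h γ
    obtain ⟨D, hD⟩ := (hper.dx_iter n).bounded (smooth_dx_iter hU n).continuous (max R 1)
    have hD0 : 0 ≤ D := (norm_nonneg _).trans (hD 0 0 (by simp))
    refine ⟨max (K * C) (max R 1 ^ γ * D), fun p => ?_⟩
    by_cases hp : |p.2| ≤ max R 1
    · refine le_trans ?_ (le_max_right _ _)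
      exact mul_le_mul (pow_le_pow_left₀ (abs_nonneg _) hp γ) (hD p.1 p.2 hp) (norm_nonneg _)
        (by positivity)
    · have hp' := (max_lt_iff.1 (not_le.1 hp))
      have hpos : 0 < |p.2| ^ γ := pow_pos (by linarith [hp'.2]) γ
      refine le_trans ?_ (le_max_left _ _)
      -- The bound is linear in the source at a fixed frequency, so decay passes from the source to
      -- the solution. Taking `max R 1` as threshold keeps `|x|` away from zero for the division.
      have := hap n p.2 hp'.1.le (C / |p.2| ^ γ) (fun t => by
        rw [le_div_iff₀ hpos, mul_comm]; exact hC (t, p.2)) p.1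
      calc |p.2| ^ γ * ‖dx^[n] U p‖ ≤ |p.2| ^ γ * (K * (C / |p.2| ^ γ)) := by gcongr
        _ = K * C := by field_simp
  have source (N n : ℕ) (h : ∀ m < n, DecaysT N (dx^[m] U)) :
      DecaysT N (symP c q (dx^[n] U)) := by
    rcases n with _ | n
    · exact decaysT_of_isSchwartz hF N
    · have e : symP c q (dx^[n + 1] U) = dx^[n + 1] (symP c q U) +
          (-((n + 1 : ℂ) * (2 * Real.pi * I))) • fun p => c p.1 * dx^[n] U p := by
        rw [dx_iter_symP c q hU, neg_smul, add_neg_cancel_right]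
      have hs := c.smooth_mul (smooth_dx_iter hU n)
      rw [e]
      exact (decaysT_of_isSchwartz (hF.dx_iter _) N).add (hF.dx_iter _).smooth
        (smooth_smul _ hs) (((h n (by omega)).mul c (smooth_dx_iter hU n)).smul _)
  have base : ∀ n, DecaysT 0 (dx^[n] U) := by
    intro n
    induction n using Nat.strong_induction_on with
    | _ n ih =>
      intro j hj
      obtain rfl : j = 0 := by omega
      exact step n (source 0 n ih 0 le_rfl)
  -- Once the `x`-derivatives decay, the equation itself expresses each further `t`-derivative
  -- through terms already controlled.
  have main : ∀ N n, DecaysT N (dx^[n] U) := by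
    intro N
    induction N with
    | zero => exact base
    | succ N ih =>
      intro n j hj
      rcases j with _ | j
      · exact base n 0 le_rfl
      · have hs := smooth_dx_iter hU n
        have e : dt (dx^[n] U) = symP c q (dx^[n] U) +
            ((-(2 * Real.pi * I : ℂ)) • xmul (fun p => c p.1 * dx^[n] U p) +
            (-1 : ℂ) • fun p => q p.1 * dx^[n] U p) := by
          rw [symP_eq]; simp only [neg_smul, one_smul]; abel
        rw [Function.iterate_succ_apply, e]
        have s1 := smooth_smul (-(2 * Real.pi * I : ℂ)) (smooth_xmul (c.smooth_mul hs))
        have s2 := smooth_smul (-1 : ℂ) (q.smooth_mul hs)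
        exact (source N n fun m _ => ih m).add (smooth_symP c q hs) (smooth_add s1 s2)
          ((((ih n).mul c hs).xmul.smul _).add s1 s2 (((ih n).mul q hs).smul _)) j (by omega)
  exact ⟨hU, hper, fun α β => main α β α le_rfl⟩

theorem hasDerivAt_of_symP (c q : SmoothCircleFun) {W : ℝ × ℝ → ℂ} (hW : ContDiff ℝ ∞ W)
    (x t : ℝ) : HasDerivAt (fun t => W (t, x))
      (symP c q W (t, x) - (2 * Real.pi * I * x * c t + q t) * W (t, x)) t := by
  have h1 : DifferentiableAt ℝ (fun s : ℝ => W (s, x)) t :=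
    (hW.comp (contDiff_id.prodMk contDiff_const)).differentiable (by simp) t
  refine h1.hasDerivAt.congr_deriv ?_
  simp [symP, dt]

theorem symP_bound (c q : SmoothCircleFun) {W : ℝ × ℝ → ℂ} (hW : ContDiff ℝ ∞ W)
    {x M K s t : ℝ} (hM : ∀ r, ‖symP c q W (r, x)‖ ≤ M) (hst : |t - s| ≤ 2 * Real.pi)
    (hK : ∀ r ∈ Set.uIcc s t, ‖cexp (phase c q (r, x) - phase c q (t, x))‖ ≤ K) :
    ‖W (t, x)‖ ≤ ‖cexp (phase c q (s, x) - phase c q (t, x))‖ * ‖W (s, x)‖ +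
      2 * Real.pi * K * M :=
  ode_bound (w := fun t => W (t, x)) (Φ := fun t => phase c q (t, x))
    (hasDerivAt_of_symP c q hW x)
    ((smooth_symP c q hW).continuous.comp (by fun_prop)) (fun t => hasDerivAt_phase c q t x)
    hM hst hK

/-! ### Tempered functionals in the kernel of the transpose, and the solvability criterion -/

theorem seminormTR_nonneg (α β γ : ℕ) (f : SchwartzTR) : 0 ≤ seminormTR α β γ f :=
  Real.iSup_nonneg fun _ => by positivity

theorem seminormTR_le_pN {N α β γ : ℕ} (h : α + β + γ ≤ N) (f : SchwartzTR) :
    seminormTR α β γ f ≤ pN N f := by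
  refine Finset.single_le_sum (f := fun i : ℕ × ℕ × ℕ => seminormTR i.1 i.2.1 i.2.2 f)
    (fun i _ => seminormTR_nonneg _ _ _ f) (a := (α, β, γ)) ?_
  simp only [Finset.mem_filter, Finset.mem_product, Finset.mem_range]
  omega

theorem le_seminormTR (α β γ : ℕ) (f : SchwartzTR) (p : ℝ × ℝ) :
    |p.2| ^ γ * ‖dt^[α] (dx^[β] (f : ℝ × ℝ → ℂ)) p‖ ≤ seminormTR α β γ f :=
  le_ciSup (seminormTR_bddAbove α β γ f) p

theorem pF_norm_le_pN (f : SchwartzTR) (p : ℝ × ℝ) :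
    ‖pF f p‖ ≤ 2 * pN 2 f * Real.pi := by
  refine pF_norm_le_of_bound f.2 (fun t x => ?_) p
  have h1 := (le_seminormTR 0 0 0 f (t, x)).trans (seminormTR_le_pN (N := 2) (by omega) f)
  have h2 := (le_seminormTR 0 0 2 f (t, x)).trans (seminormTR_le_pN (N := 2) (by omega) f)
  simp only [pow_zero, one_mul, sq_abs, Function.iterate_zero, id] at h1 h2
  rw [← div_eq_mul_inv, le_div_iff₀ (by positivity)]
  linarith

/-- The functional `f ↦ ∫₀^{2π} e^{Φ(t,x)} (pF f)(t,x) dt`. -/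
def modeFunctional (c q : SmoothCircleFun) (x : ℝ) : SchwartzTR →ₗ[ℂ] ℂ where
  toFun f := primT (fun r => cexp (phase c q r) * pF f r) (2 * Real.pi, x)
  map_add' f g := by
    have hi (h : SchwartzTR) : IntervalIntegrable
        (fun s => cexp (phase c q (s, x)) * pF h (s, x)) volume 0 (2 * Real.pi) :=
      ((smooth_exp_phase_mul c q (smooth_pF h.2)).continuous.comp
        (by fun_prop : Continuous fun s : ℝ => (s, x))).intervalIntegrable _ _
    have e : pF ((f + g : SchwartzTR) : ℝ × ℝ → ℂ) = pF f + pF g := pF_add f.2 g.2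
    simp only [primT, e]
    rw [← intervalIntegral.integral_add (hi f) (hi g)]
    simp only [Pi.add_apply, mul_add]
  map_smul' a f := by
    have e : pF ((a • f : SchwartzTR) : ℝ × ℝ → ℂ) = a • pF f := pF_smul a f
    simp only [primT, e, RingHom.id_apply, smul_eq_mul]
    rw [← intervalIntegral.integral_const_mul]
    simp only [Pi.smul_apply, smul_eq_mul, mul_left_comm]

theorem isTempered_modeFunctional (c q : SmoothCircleFun) (x : ℝ) :
    IsTempered (modeFunctional c q x) := by
  obtain ⟨A, hA⟩ := (isCompact_Icc (a := (0 : ℝ)) (b := 2 * Real.pi)).exists_bound_of_continuousOn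
    (f := fun t => cexp (phase c q (t, x)))
    (((smooth_phase c q).continuous.comp (by fun_prop : Continuous fun s : ℝ => (s, x))).cexp
      |>.continuousOn)
  refine ⟨2, A * (2 * Real.pi) * (2 * Real.pi), fun f => ?_⟩
  have h2 : (0 : ℝ) ≤ 2 * Real.pi := by positivity
  have := intervalIntegral.norm_integral_le_of_norm_le_const (a := 0) (b := 2 * Real.pi)
    (f := fun s => cexp (phase c q (s, x)) * pF f (s, x)) (C := A * (2 * pN 2 f * Real.pi))
    (fun s hs => by
      rw [Set.uIoc_of_le h2] at hs
      have h1 := hA s ⟨hs.1.le, hs.2⟩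
      rw [norm_mul]
      exact mul_le_mul h1 (pF_norm_le_pN f _) (norm_nonneg _) ((norm_nonneg _).trans h1))
  rw [sub_zero, abs_of_nonneg h2] at this
  refine this.trans (le_of_eq ?_)
  ring

/-- `e^Φ symP(pF f)` is the `t`-derivative of `e^Φ pF f`, which takes equal values at `0` and `2π`
when `x` is resonant. -/
theorem transposeL_modeFunctional (c q : SmoothCircleFun) {x : ℝ}
    (hx : cexp (phase c q (2 * Real.pi, x)) = 1) :
    transposeL c q (modeFunctional c q x) = 0 := by
  refine LinearMap.ext fun f => ?_
  have hF := smooth_pF f.2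
  have hd : ∀ t, HasDerivAt (fun t => cexp (phase c q (t, x)) * pF f (t, x))
      (cexp (phase c q (t, x)) * symP c q (pF f) (t, x)) t := by
    intro t
    refine ((hasDerivAt_phase c q t x).cexp.mul (hasDerivAt_of_symP c q hF x t)).congr_deriv ?_
    ring
  have hi := intervalIntegral.integral_eq_sub_of_hasDerivAt (a := 0) (b := 2 * Real.pi)
    (fun r _ => hd r) (((smooth_exp_phase_mul c q (smooth_symP c q hF)).continuous.comp
      (by fun_prop : Continuous fun s : ℝ => (s, x))).intervalIntegrable _ _)
  have h0 : phase c q (0, x) = 0 := by simp [phase, prim]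
  have hp := (isSchwartz_pF f.2).periodic 0 x
  rw [zero_add] at hp
  rw [hx, h0, Complex.exp_zero, hp, sub_self] at hi
  simp only [transposeL, LinearMap.comp_apply, modeFunctional, LinearMap.coe_mk, AddHom.coe_mk,
    LinearMap.zero_apply]
  rw [pF_opL]
  exact hi

theorem primT_eq_zero_of_mem_annihilator (c q : SmoothCircleFun) {f : SchwartzTR}
    (hf : f ∈ kerTransposeAnnihilator c q) {x : ℝ}
    (hx : cexp (phase c q (2 * Real.pi, x)) = 1) :
    primT (fun r => cexp (phase c q r) * pF f r) (2 * Real.pi, x) = 0 :=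
  hf _ (isTempered_modeFunctional c q x) (transposeL_modeFunctional c q hx)

/-- Solvability criterion: it suffices to find a smooth `κ` solving the periodicity condition
for which the corresponding solution satisfies an a priori bound. -/
theorem exists_solution_of_apriori (c q : SmoothCircleFun) (f : SchwartzTR) {κ : ℝ → ℂ}
    (hκ : ContDiff ℝ ∞ κ)
    (hm : ∀ x, primT (fun r => cexp (phase c q r) * pF f r) (2 * Real.pi, x) =
      (cexp (phase c q (2 * Real.pi, x)) - 1) * κ x) (R K : ℝ)
    (hap : ∀ n x, R ≤ |x| → ∀ M, PeriodicT (dx^[n] (sol c q (pF f) κ)) →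
      (∀ t, ‖symP c q (dx^[n] (sol c q (pF f) κ)) (t, x)‖ ≤ M) →
      ∀ t, ‖dx^[n] (sol c q (pF f) κ) (t, x)‖ ≤ K * M) :
    ∃ u : SchwartzTR, opL c q u = f := by
  have hF := isSchwartz_pF f.2
  have hs := smooth_sol c q hF.smooth hκ
  have hp : PeriodicT (sol c q (pF f) κ) := sol_periodic c q hF.smooth hF.periodic hm
  have hP := symP_sol c q hF.smooth κ
  have hU : IsSchwartz (sol c q (pF f) κ) :=
    isSchwartz_of_apriori c q hs hp (by rw [hP]; exact hF) R K
      fun n x hx M hM => hap n x hx M (hp.dx_iter n) hM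
  exact ⟨_, opL_eq_of_symP c q hU f hP⟩

/-! ### Connected sublevel sets and the fully resonant case -/

/-- The points `u` and `v` cut the circle into the disjoint open arcs `(u, v)` and `(v, u + 2π)`.
They cover the sublevel set, and each meets it, the first at `a'` and the second at `a + 2π`. -/
theorem sublevel_no_separation {B : ℝ → ℝ} (hB : Function.Periodic B (2 * Real.pi)) {r : ℝ}
    (hS : IsPreconnected ((fun t : ℝ => (t : AddCircle (2 * Real.pi))) '' {t | B t < r}))
    {a u a' v : ℝ} (h1 : a < u) (h2 : u < a') (h3 : a' < v) (h4 : v < a + 2 * Real.pi)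
    (ha : B a < r) (ha' : B a' < r) (hu : r ≤ B u) (hv : r ≤ B v) : False := by
  have hpi : (0 : ℝ) < 2 * Real.pi := by positivity
  have hmem (t s : ℝ) (h : (t : AddCircle (2 * Real.pi)) = s) :
      ∃ n : ℤ, t - s = n * (2 * Real.pi) := by
    have : ((t - s : ℝ) : AddCircle (2 * Real.pi)) = 0 := by
      rw [AddCircle.coe_sub, h, sub_self]
    obtain ⟨n, hn⟩ := (AddCircle.coe_eq_zero_iff _).1 this
    exact ⟨n, by rw [← hn]; simp⟩
  let V (x y : ℝ) : Set (AddCircle (2 * Real.pi)) :=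
    (fun t : ℝ => (t : AddCircle (2 * Real.pi))) '' Set.Ioo x y
  have hV (x y) : IsOpen (V x y) := QuotientAddGroup.isOpenMap_coe _ isOpen_Ioo
  obtain ⟨z, -, ⟨x, hx, rfl⟩, y, hy, hxy⟩ := hS (V u v) (V v (u + 2 * Real.pi)) (hV _ _) (hV _ _)
    (by
      rintro _ ⟨t, ht, rfl⟩
      have htm := toIcoMod_mem_Ico hpi u t
      set t' := toIcoMod hpi u t with ht'
      have e : ((t' : ℝ) : AddCircle (2 * Real.pi)) = t := by
        rw [ht', toIcoMod, AddCircle.coe_sub, sub_eq_self, AddCircle.coe_eq_zero_iff]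
        exact ⟨_, rfl⟩
      have hBt : B t' = B t := hB.sub_zsmul_eq _
      have hlt : B t' < r := hBt ▸ ht
      have n1 : u ≠ t' := fun h => by rw [h] at hu; linarith
      have n2 : t' ≠ v := fun h => by rw [h] at hlt; linarith
      rcases lt_or_gt_of_ne n2 with h | h
      · exact .inl ⟨t', ⟨lt_of_le_of_ne htm.1 n1, h⟩, e⟩
      · exact .inr ⟨t', ⟨h, htm.2⟩, e⟩)
    ⟨_, ⟨a', ha', rfl⟩, a', ⟨h2, h3⟩, rfl⟩
    ⟨_, ⟨a, ha, rfl⟩, a + 2 * Real.pi, ⟨h4, by linarith⟩, by simp⟩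
  obtain ⟨n, hn⟩ := hmem y x hxy
  have e1 : 0 < (n : ℝ) * (2 * Real.pi) := by rw [← hn]; linarith [hx.2, hy.1]
  have e2 : (n : ℝ) * (2 * Real.pi) < 1 * (2 * Real.pi) := by rw [← hn]; linarith [hx.1, hy.2]
  have e3 : (0 : ℝ) < n := pos_of_mul_pos_left e1 hpi.le
  have e4 : (n : ℝ) < 1 := lt_of_mul_lt_mul_right e2 hpi.le
  have e5 : 0 < n := by exact_mod_cast e3
  have e6 : n < 1 := by exact_mod_cast e4
  omega

/-- If both arcs from the minimum `a` to `t` contained a value above `B t`, then for `r` slightly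
above `B t` these two points would separate `a` from `t` in the sublevel set. -/
theorem exists_arc_le {B : ℝ → ℝ} (hB : Function.Periodic B (2 * Real.pi))
    (hS : ∀ r, IsPreconnected ((fun t : ℝ => (t : AddCircle (2 * Real.pi))) '' {t | B t < r}))
    {a t : ℝ} (ha : ∀ s, B a ≤ B s) :
    (∀ s ∈ Set.Icc a t, B s ≤ B t) ∨ (∀ s ∈ Set.Icc t (a + 2 * Real.pi), B s ≤ B t) := by
  by_contra! h
  obtain ⟨⟨s₁, h₁, h₁'⟩, s₂, h₂, h₂'⟩ := h
  obtain ⟨r, hr, hr'⟩ := exists_between (lt_min h₁' h₂')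
  have e := hB a
  refine sublevel_no_separation hB (hS r) (lt_of_le_of_ne h₁.1 fun h => ?_)
    (lt_of_le_of_ne h₁.2 fun h => ?_) (lt_of_le_of_ne h₂.1 fun h => ?_)
    (lt_of_le_of_ne h₂.2 fun h => ?_) ((ha t).trans_lt hr) hr
    (hr'.le.trans (min_le_left _ _)) (hr'.le.trans (min_le_right _ _)) <;>
  · have := congrArg B h
    linarith [ha t]

/-- If both arcs dipped below `B t`, the two low points would be separated, in the sublevel set at
`r = B t`, by `t` and by the maximum. The strict inequality defining sublevel sets allows this level
itself. -/
theorem exists_arc_ge {B : ℝ → ℝ} (hB : Function.Periodic B (2 * Real.pi))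
    (hS : ∀ r, IsPreconnected ((fun t : ℝ => (t : AddCircle (2 * Real.pi))) '' {t | B t < r}))
    {a t : ℝ} (ha : ∀ s, B s ≤ B a) :
    (∀ s ∈ Set.Icc a t, B t ≤ B s) ∨ (∀ s ∈ Set.Icc t (a + 2 * Real.pi), B t ≤ B s) := by
  by_contra! h
  obtain ⟨⟨s₁, h₁, h₁'⟩, s₂, h₂, h₂'⟩ := h
  have e := hB a
  have n1 : a ≠ s₁ := by rintro rfl; linarith [ha t]
  have h5 := lt_of_le_of_ne h₁.1 n1
  refine sublevel_no_separation hB (hS (B t)) (lt_of_le_of_ne h₁.2 fun h => ?_)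
    (lt_of_le_of_ne h₂.1 fun h => ?_) (lt_of_le_of_ne h₂.2 fun h => ?_)
    (v := a + 2 * Real.pi) (by linarith) h₁' h₂' le_rfl (e ▸ ha t) <;>
  · have := congrArg B h
    linarith [ha t]

theorem exp_sub_phase_norm (c q : SmoothCircleFun) (s t x : ℝ) :
    ‖cexp (phase c q (s, x) - phase c q (t, x))‖ =
      Real.exp (-(2 * Real.pi * (x * ((prim c s).im - (prim c t).im))) +
        ((prim q s).re - (prim q t).re)) := by
  rw [Complex.norm_exp]
  congr 1
  simp [phase]
  ring

theorem prim_re_sub_le {q : SmoothCircleFun} {A : ℝ} (hA : ∀ t, ‖q t‖ ≤ A) {s t : ℝ}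
    (hst : |t - s| ≤ 2 * Real.pi) : (prim q s).re - (prim q t).re ≤ 2 * Real.pi * A := by
  have hi := fun a b => q.smooth.continuous.intervalIntegrable (μ := volume) a b
  have h : prim q s - prim q t = ∫ r in t..s, q r :=
    intervalIntegral.integral_interval_sub_left (hi _ _) (hi _ _)
  have h2 : ‖∫ r in t..s, q r‖ ≤ A * |s - t| :=
    intervalIntegral.norm_integral_le_of_norm_le_const fun r _ => hA r
  rw [← Complex.sub_re, h]
  refine (Complex.re_le_norm _).trans (h2.trans ?_)
  rw [abs_sub_comm, mul_comm]
  exact mul_le_mul_of_nonneg_right hst ((norm_nonneg _).trans (hA 0))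

/-- The sign condition discards the only part of the exponent that depends on `x`, leaving a
constant uniform in the frequency. -/
theorem exp_sub_phase_norm_le (c : SmoothCircleFun) {q : SmoothCircleFun} {A : ℝ}
    (hA : ∀ t, ‖q t‖ ≤ A) {s t x : ℝ} (hst : |t - s| ≤ 2 * Real.pi)
    (hx : 0 ≤ x * ((prim c s).im - (prim c t).im)) :
    ‖cexp (phase c q (s, x) - phase c q (t, x))‖ ≤ Real.exp (2 * Real.pi * A) := by
  rw [exp_sub_phase_norm]
  refine Real.exp_le_exp.2 ?_
  have := prim_re_sub_le hA hst
  have : 0 ≤ 2 * Real.pi * (x * ((prim c s).im - (prim c t).im)) := by positivity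
  linarith

theorem prim_im (c : SmoothCircleFun) (t : ℝ) :
    (prim c t).im = ∫ τ in (0 : ℝ)..t, (c τ).im :=
  (imCLM.intervalIntegral_comp_comm (c.smooth.continuous.intervalIntegrable 0 t)).symm

theorem continuous_prim (c : SmoothCircleFun) : Continuous (prim c) := (smooth_prim c).continuous

theorem uIcc_abs_le {s t r : ℝ} (hr : r ∈ Set.uIcc s t) (hst : |t - s| ≤ 2 * Real.pi) :
    |t - r| ≤ 2 * Real.pi :=
  (Set.abs_sub_le_of_uIcc_subset_uIcc (Set.uIcc_subset_uIcc hr Set.right_mem_uIcc)).trans hst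

theorem dx_iter_eq_zero {U : ℝ × ℝ → ℂ} {s : ℝ} {S : Set ℝ} (hS : IsOpen S)
    (h : ∀ x ∈ S, U (s, x) = 0) (n : ℕ) : ∀ x ∈ S, dx^[n] U (s, x) = 0 := by
  induction n with
  | zero => exact h
  | succ n ih =>
    intro x hx
    rw [Function.iterate_succ_apply']
    have : (fun y : ℝ => dx^[n] U (s, y)) =ᶠ[nhds x] fun _ => 0 :=
      Filter.eventually_of_mem (hS.mem_nhds hx) ih
    exact this.deriv_eq.trans (deriv_const _ _)

theorem PeriodicT.exists_mem_Ico {f : ℝ × ℝ → ℂ} (hf : PeriodicT f) (a t x : ℝ) :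
    ∃ s ∈ Set.Ico a (a + 2 * Real.pi), f (t, x) = f (s, x) := by
  have hp : Function.Periodic (fun t => f (t, x)) (2 * Real.pi) := fun t => hf t x
  exact hp.exists_mem_Ico (by positivity) t a

theorem globallySolvable_of_sublevel (c q : SmoothCircleFun) (hc : mean c = 0)
    (hq : ∃ k : ℤ, mean q = I * (k : ℂ))
    (hS : ∀ r : ℝ, IsPreconnected (sublevel (fun t => (c t).im) r)) :
    GloballySolvable c q := by
  intro f hf
  obtain ⟨k, hk⟩ := hq
  have hF := isSchwartz_pF f.2
  set G : ℝ × ℝ → ℂ := fun r => cexp (phase c q r) * pF f r with hG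
  have hGs : ContDiff ℝ ∞ G := smooth_exp_phase_mul c q hF.smooth
  have hcp : prim c (2 * Real.pi) = 0 := by rw [two_pi_mul_mean, hc, mul_zero]
  have hone : ∀ x, cexp (phase c q (2 * Real.pi, x)) = 1 := by
    intro x
    simp only [phase, hcp, two_pi_mul_mean q, hk]
    exact Complex.exp_eq_one_iff.2 ⟨k, by ring⟩
  set B : ℝ → ℝ := fun t => (prim c t).im with hBdef
  have hBp : Function.Periodic B (2 * Real.pi) := fun t => by
    simp only [hBdef, prim_add, hcp, add_zero]
  have hBc : Continuous B := Complex.continuous_im.comp (continuous_prim c)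
  have hS' : ∀ r, IsPreconnected
      ((fun t : ℝ => (t : AddCircle (2 * Real.pi))) '' {t | B t < r}) := by
    intro r
    have := hS r
    simp only [sublevel, ← prim_im] at this
    exact this
  have hne : (Set.Icc 0 (2 * Real.pi)).Nonempty := ⟨0, by simp [Real.pi_pos.le]⟩
  have hred (t : ℝ) : ∃ s ∈ Set.Icc 0 (2 * Real.pi), B t = B s := by
    obtain ⟨s, hs, h⟩ := hBp.exists_mem_Ico₀ (by positivity) t
    exact ⟨s, ⟨hs.1, hs.2.le⟩, h⟩
  obtain ⟨a, -, ha⟩ := isCompact_Icc.exists_isMinOn hne hBc.continuousOn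
  obtain ⟨a', -, ha'⟩ := isCompact_Icc.exists_isMaxOn hne hBc.continuousOn
  have hmin : ∀ s, B a ≤ B s := fun s => by
    obtain ⟨s', h, e⟩ := hred s; rw [e]; exact ha h
  have hmax : ∀ s, B s ≤ B a' := fun s => by
    obtain ⟨s', h, e⟩ := hred s; rw [e]; exact ha' h
  let g : ℝ → ℂ := fun x => (Real.smoothTransition x : ℂ)
  have hg : ContDiff ℝ ∞ g := ofRealCLM.contDiff.comp Real.smoothTransition.contDiff
  have hI (s : ℝ) : ContDiff ℝ ∞ fun x : ℝ => primT G (s, x) :=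
    (smooth_primT hGs).comp (contDiff_const.prodMk contDiff_id)
  -- Periodicity puts no constraint on `κ` here. This choice makes the solution vanish at the
  -- minimum `a` for `x < 0` and at the maximum `a'` for `x > 1`, with a smooth interpolation
  -- between.
  set κ : ℝ → ℂ := fun x => -(g x * primT G (a', x) + (1 - g x) * primT G (a, x)) with hκdef
  have hκ : ContDiff ℝ ∞ κ :=
    ((hg.mul (hI a')).add ((contDiff_const.sub hg).mul (hI a))).neg
  obtain ⟨A, hA⟩ := q.bounded
  set U := sol c q (pF f) κ with hU
  have hUs : ContDiff ℝ ∞ U := smooth_sol c q hF.smooth hκ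
  have hz1 : ∀ x ∈ Set.Iio (0 : ℝ), U (a, x) = 0 := by
    intro x hx
    simp [hU, sol, hκdef, g, Real.smoothTransition.zero_of_nonpos (le_of_lt hx), ← hG]
  have hz2 : ∀ x ∈ Set.Ioi (1 : ℝ), U (a', x) = 0 := by
    intro x hx
    simp [hU, sol, hκdef, g, Real.smoothTransition.one_of_one_le (le_of_lt hx), ← hG]
  refine exists_solution_of_apriori c q f hκ (fun x => ?_) 2
    (2 * Real.pi * Real.exp (2 * Real.pi * A)) ?_
  · rw [hone, sub_self, zero_mul]
    exact primT_eq_zero_of_mem_annihilator c q hf (hone x)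
  · intro n x hx M hper hM t
    have hW := smooth_dx_iter hUs n
    -- All `x`-derivatives of `U` vanish at the same base point, as `U` vanishes there for an open
    -- set of `x`; hence no initial term survives.
    have key (s t : ℝ) (hst : |t - s| ≤ 2 * Real.pi) (h0 : dx^[n] U (s, x) = 0)
        (h : ∀ r ∈ Set.uIcc s t, 0 ≤ x * (B r - B t)) :
        ‖dx^[n] U (t, x)‖ ≤ 2 * Real.pi * Real.exp (2 * Real.pi * A) * M := by
      have := symP_bound c q hW hM hst fun r hr =>
        exp_sub_phase_norm_le c hA (uIcc_abs_le hr hst) (h r hr)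
      rwa [h0, norm_zero, mul_zero, zero_add] at this
    have hpi := Real.pi_pos
    rcases le_abs.1 hx with hx | hx
    · obtain ⟨t', ht', e⟩ := hper.exists_mem_Ico a' t x
      have h0 := dx_iter_eq_zero isOpen_Ioi hz2 n x (by rw [Set.mem_Ioi]; linarith)
      have h0' : dx^[n] U (a' + 2 * Real.pi, x) = 0 := (hper a' x).trans h0
      rw [e]
      rcases exists_arc_ge hBp hS' (t := t') hmax with h | h
      · refine key a' t' (abs_le.2 ⟨by linarith [ht'.1], by linarith [ht'.2]⟩) h0 fun r hr => ?_
        rw [Set.uIcc_of_le ht'.1] at hr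
        exact mul_nonneg (by linarith) (sub_nonneg.2 (h r hr))
      · refine key _ t' (abs_le.2 ⟨by linarith [ht'.1], by linarith [ht'.2]⟩) h0' fun r hr => ?_
        rw [Set.uIcc_of_ge ht'.2.le] at hr
        exact mul_nonneg (by linarith) (sub_nonneg.2 (h r hr))
    · obtain ⟨t', ht', e⟩ := hper.exists_mem_Ico a t x
      have h0 := dx_iter_eq_zero isOpen_Iio hz1 n x (by rw [Set.mem_Iio]; linarith)
      have h0' : dx^[n] U (a + 2 * Real.pi, x) = 0 := (hper a x).trans h0
      rw [e]
      rcases exists_arc_le hBp hS' (t := t') hmin with h | h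
      · refine key a t' (abs_le.2 ⟨by linarith [ht'.1], by linarith [ht'.2]⟩) h0 fun r hr => ?_
        rw [Set.uIcc_of_le ht'.1] at hr
        exact mul_nonneg_of_nonpos_of_nonpos (by linarith) (sub_nonpos.2 (h r hr))
      · refine key _ t' (abs_le.2 ⟨by linarith [ht'.1], by linarith [ht'.2]⟩) h0' fun r hr => ?_
        rw [Set.uIcc_of_ge ht'.2.le] at hr
        exact mul_nonneg_of_nonpos_of_nonpos (by linarith) (sub_nonpos.2 (h r hr))

/-! ### Smooth division and the case of constant sign -/

/-- Hadamard's lemma in one variable. -/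
theorem exists_smooth_factor {f : ℝ → ℂ} (hf : ContDiff ℝ ∞ f) {a : ℝ} (ha : f a = 0) :
    ∃ g : ℝ → ℂ, ContDiff ℝ ∞ g ∧ (∀ x, f x = ((x - a : ℝ) : ℂ) * g x) ∧ g a = deriv f a := by
  have hf' : ContDiff ℝ ∞ (deriv f) := hf.iterate_deriv 1
  refine ⟨fun x => ∫ s in (0 : ℝ)..1, deriv f (a + s * (x - a)), ?_, fun x => ?_, by simp⟩
  · have h := smooth_integral_zero_one (F := fun y => deriv f (a + y.2 * (y.1.1 - a)))
      (hf'.comp (by fun_prop))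
    exact h.comp (contDiff_id.prodMk (contDiff_const (c := (0 : ℝ))))
  · have h := intervalIntegral.integral_eq_sub_of_hasDerivAt (a := 0) (b := 1)
      (f := fun s : ℝ => f (a + s * (x - a)))
      (f' := fun s : ℝ => ((x - a : ℝ) : ℂ) * deriv f (a + s * (x - a))) (fun s _ => ?_)
      (Continuous.intervalIntegrable (continuous_const.mul
        (hf'.continuous.comp (by fun_prop))) _ _)
    · rw [intervalIntegral.integral_const_mul] at h
      rw [h]; simp [ha]
    · have h1 : HasDerivAt (fun s : ℝ => a + s * (x - a)) (x - a) s := by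
        simpa using ((hasDerivAt_id s).mul_const (x - a)).const_add a
      have h2 := (hf.differentiable (by simp) (a + s * (x - a))).hasDerivAt
      have h3 := h2.scomp s h1
      rwa [Complex.real_smul] at h3

/-- Division of a smooth function by one with at most one zero, which is simple. -/
theorem exists_smooth_quotient {m E : ℝ → ℂ} (hm : ContDiff ℝ ∞ m) (hE : ContDiff ℝ ∞ E)
    (hz : ∀ x, E x = 0 → m x = 0) (hd : ∀ x, E x = 0 → deriv E x ≠ 0)
    (hu : ∀ x y, E x = 0 → E y = 0 → x = y) :
    ∃ κ : ℝ → ℂ, ContDiff ℝ ∞ κ ∧ ∀ x, m x = E x * κ x := by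
  by_cases h : ∃ a, E a = 0
  · obtain ⟨a, ha⟩ := h
    obtain ⟨m₁, hm₁, em, -⟩ := exists_smooth_factor hm (hz a ha)
    obtain ⟨E₁, hE₁, eE, hE₁a⟩ := exists_smooth_factor hE ha
    have hne : ∀ x, E₁ x ≠ 0 := by
      intro x hx
      have : E x = 0 := by rw [eE, hx, mul_zero]
      obtain rfl := hu x a this ha
      exact hd x ha (hE₁a ▸ hx)
    refine ⟨fun x => m₁ x * (E₁ x)⁻¹, hm₁.mul (hE₁.inv hne), fun x => ?_⟩
    rw [em, eE]
    have := hne x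
    field_simp
  · push Not at h
    exact ⟨fun x => m x * (E x)⁻¹, hm.mul (hE.inv h), fun x => by have := h x; field_simp⟩

theorem globallySolvable_of_no_sign_change (c q : SmoothCircleFun) (hne : ∃ t, (c t).im ≠ 0)
    (hb : (∀ t, 0 ≤ (c t).im) ∨ (∀ t, (c t).im ≤ 0)) : GloballySolvable c q := by
  intro f hf
  have hpi := Real.pi_pos
  have hF := isSchwartz_pF f.2
  set B : ℝ → ℝ := fun t => (prim c t).im with hBdef
  have hBd : ∀ t, HasDerivAt B (c t).im t := fun t =>
    imCLM.hasFDerivAt.comp_hasDerivAt t (hasDerivAt_prim c.smooth.continuous t)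
  obtain ⟨β, hβ⟩ : ∃ β, β = (prim c (2 * Real.pi)).im := ⟨_, rfl⟩
  have hBadd : ∀ t, B (t + 2 * Real.pi) = B t + β := fun t => by
    simp only [hBdef, prim_add, add_im, hβ]
  have hBsub : ∀ t, B (t - 2 * Real.pi) = B t - β := fun t => by
    have := hBadd (t - 2 * Real.pi); rw [sub_add_cancel] at this; linarith
  -- The sign `σ` lets both signs of `b` be treated together.
  obtain ⟨σ, hσ, hσB, hσβ⟩ : ∃ σ : ℝ, (σ = 1 ∨ σ = -1) ∧ Monotone (fun t => σ * B t) ∧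
      0 ≤ σ * β := by
    have main : ∀ σ : ℝ, (∀ t, 0 ≤ σ * (c t).im) → Monotone (fun t => σ * B t) := fun σ h =>
      monotone_of_deriv_nonneg (fun t => ((hBd t).const_mul σ).differentiableAt)
        fun t => by rw [((hBd t).const_mul σ).deriv]; exact h t
    have fin : ∀ σ : ℝ, Monotone (fun t => σ * B t) → 0 ≤ σ * β := fun σ h => by
      have := h (show (0 : ℝ) ≤ 0 + 2 * Real.pi by linarith)
      simp only [hBadd, mul_add] at this
      linarith
    rcases hb with h | h
    · have := main 1 (fun t => by simpa using h t)
      exact ⟨1, .inl rfl, this, fin _ this⟩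
    · have := main (-1) (fun t => by simpa using h t)
      exact ⟨-1, .inr rfl, this, fin _ this⟩
  have hσ0 : σ ≠ 0 := by rcases hσ with rfl | rfl <;> norm_num
  -- A monotone `B` with zero increment over a period would be constant, forcing `b` to vanish.
  have hβ0 : β ≠ 0 := by
    rintro rfl
    obtain ⟨t, ht⟩ := hne
    have hconst : ∀ s ∈ Set.Icc (t - Real.pi) (t + Real.pi), B s = B (t - Real.pi) := by
      intro s hs
      have h1 := hσB hs.1
      have h2 := hσB hs.2
      have h3 := hBadd (t - Real.pi)
      rw [show t - Real.pi + 2 * Real.pi = t + Real.pi by ring, add_zero] at h3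
      simp only [h3] at h1 h2
      exact mul_left_cancel₀ hσ0 (le_antisymm h2 h1)
    have hev : B =ᶠ[nhds t] fun _ => B (t - Real.pi) :=
      Filter.eventually_of_mem (Icc_mem_nhds (by linarith) (by linarith)) hconst
    exact ht ((hBd t).deriv.symm.trans (hev.deriv_eq.trans (deriv_const _ _)))
  set E : ℝ → ℂ := fun x => cexp (phase c q (2 * Real.pi, x)) - 1 with hEdef
  have hEs : ContDiff ℝ ∞ E :=
    ((smooth_phase c q).comp (contDiff_const.prodMk contDiff_id)).cexp.sub contDiff_const
  have hEd : ∀ x : ℝ, HasDerivAt E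
      (cexp (phase c q (2 * Real.pi, x)) * (2 * Real.pi * I * prim c (2 * Real.pi))) x := by
    intro x
    have h1 : HasDerivAt (fun y : ℝ => (y : ℂ)) 1 x := ofRealCLM.hasDerivAt
    have h2 := (((h1.const_mul (2 * Real.pi * I : ℂ)).mul_const (prim c (2 * Real.pi))).add_const
      (prim q (2 * Real.pi))).cexp.sub_const 1
    rw [mul_one] at h2
    exact h2
  -- Taking moduli in `e^{Φ(2π,x)} = 1` gives a linear equation for `x` with slope `2πβ ≠ 0`, so
  -- there is at most one resonance.
  have hEz : ∀ x, E x = 0 → 2 * Real.pi * x * β = (prim q (2 * Real.pi)).re := by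
    intro x hx
    have h1 : ‖cexp (phase c q (2 * Real.pi, x))‖ = 1 := by rw [sub_eq_zero.1 hx, norm_one]
    rw [Complex.norm_exp, Real.exp_eq_one_iff] at h1
    simp [phase] at h1
    rw [hβ]; linarith
  have hGs := smooth_exp_phase_mul c q hF.smooth
  obtain ⟨κ, hκ, hm⟩ := exists_smooth_quotient
    (m := fun x => primT (fun r => cexp (phase c q r) * pF f r) (2 * Real.pi, x)) (E := E)
    ((smooth_primT hGs).comp (contDiff_const.prodMk contDiff_id)) hEs
    (fun x hx => primT_eq_zero_of_mem_annihilator c q hf (sub_eq_zero.1 hx))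
    (fun x _ => by
      rw [(hEd x).deriv]
      have : prim c (2 * Real.pi) ≠ 0 := fun h => hβ0 (by rw [hβ, h]; rfl)
      have hpi' : (Real.pi : ℂ) ≠ 0 := by exact_mod_cast hpi.ne'
      simp [Complex.exp_ne_zero, this, hpi'])
    (fun x y hx hy => by
      have := (hEz x hx).trans (hEz y hy).symm
      exact mul_left_cancel₀ (show 2 * Real.pi ≠ 0 by positivity) (mul_right_cancel₀ hβ0 this))
  obtain ⟨A, hA⟩ := q.bounded
  have hA0 : 0 ≤ A := (norm_nonneg _).trans (hA 0)
  -- Beyond this radius `exp(2πA - 2π|x||β|) ≤ 1/2`, so a full turn contracts by `1/2`. Absorbing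
  -- that half doubles the constant `2π e^{2πA}`.
  refine exists_solution_of_apriori c q f hκ hm
    ((2 * Real.pi * A + Real.log 2) / (2 * Real.pi * |β|))
    (4 * Real.pi * Real.exp (2 * Real.pi * A)) ?_
  intro n x hx M hper hM t
  have hW := smooth_dx_iter (smooth_sol c q hF.smooth hκ) n
  have hβ' : 0 < |β| := abs_pos.2 hβ0
  rw [div_le_iff₀ (by positivity)] at hx
  have key (s : ℝ) (hst : |t - s| ≤ 2 * Real.pi)
      (hs : dx^[n] (sol c q (pF f) κ) (s, x) = dx^[n] (sol c q (pF f) κ) (t, x))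
      (h : ∀ r ∈ Set.uIcc s t, 0 ≤ x * (B r - B t)) (hB : |B s - B t| = |β|) :
      ‖dx^[n] (sol c q (pF f) κ) (t, x)‖ ≤ 4 * Real.pi * Real.exp (2 * Real.pi * A) * M := by
    have h1 := symP_bound c q hW hM hst fun r hr =>
      exp_sub_phase_norm_le c hA (uIcc_abs_le hr hst) (h r hr)
    have h2 : ‖cexp (phase c q (s, x) - phase c q (t, x))‖ ≤ 1 / 2 := by
      rw [exp_sub_phase_norm, one_div, ← Real.exp_log (show (0 : ℝ) < 2⁻¹ by norm_num),
        Real.log_inv]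
      refine Real.exp_le_exp.2 ?_
      have h3 := prim_re_sub_le hA hst
      have h4 : x * (B s - B t) = |x| * |β| := by
        rw [← hB, ← abs_mul, abs_of_nonneg (h s Set.left_mem_uIcc)]
      have h5 : 2 * Real.pi * (x * ((prim c s).im - (prim c t).im)) = |x| * (2 * Real.pi * |β|) := by
        rw [show x * ((prim c s).im - (prim c t).im) = |x| * |β| from h4]; ring
      rw [h5]; linarith
    rw [hs] at h1
    nlinarith [norm_nonneg (dx^[n] (sol c q (pF f) κ) (t, x))]
  have hsgn : ∀ r, σ * x * (σ * B r - σ * B t) = x * (B r - B t) := by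
    intro r; rcases hσ with rfl | rfl <;> ring
  -- The sign of `σ x` decides whether the full turn ending at `t` starts at `t + 2π` or at `t -
  -- 2π`.
  rcases le_total 0 (σ * x) with h | h
  · refine key (t + 2 * Real.pi) (by simp [abs_of_pos hpi]) (hper t x) (fun r hr => ?_) (by
      rw [hBadd]; simp)
    rw [Set.uIcc_of_ge (by linarith)] at hr
    rw [← hsgn]
    exact mul_nonneg h (sub_nonneg.2 (hσB hr.1))
  · have hp := hper (t - 2 * Real.pi) x
    rw [sub_add_cancel] at hp
    refine key (t - 2 * Real.pi) (by simp [abs_of_pos hpi]) hp.symm (fun r hr => ?_) (by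
      rw [hBsub]; simp)
    rw [Set.uIcc_of_le (by linarith)] at hr
    rw [← hsgn]
    exact mul_nonneg_of_nonpos_of_nonpos h (sub_nonpos.2 (hσB hr.2))

/-! ### Waves with exponentially decaying amplitude -/

/-- Smooth functions vanishing on the negative half-line with all derivatives bounded. -/
structure IsCutoff (a : ℝ → ℂ) : Prop where
  smooth : ContDiff ℝ ∞ a
  zero : ∀ x < 0, a x = 0
  bounded : ∀ n, ∃ C, ∀ x, ‖deriv^[n] a x‖ ≤ C

theorem IsCutoff.deriv {a : ℝ → ℂ} (ha : IsCutoff a) : IsCutoff (deriv a) where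
  smooth := ha.smooth.iterate_deriv 1
  zero x hx := by
    have : a =ᶠ[nhds x] fun _ => 0 := Filter.eventually_of_mem (Iio_mem_nhds hx) ha.zero
    exact this.deriv_eq.trans (deriv_const _ _)
  bounded n := ha.bounded (n + 1)

theorem isCutoff_smoothTransition : IsCutoff fun x => (Real.smoothTransition x : ℂ) where
  smooth := ofRealCLM.contDiff.comp Real.smoothTransition.contDiff
  zero x hx := by rw [Real.smoothTransition.zero_of_nonpos hx.le, ofReal_zero]
  bounded n := by
    set a : ℝ → ℂ := fun x => (Real.smoothTransition x : ℂ)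
    have ha : ContDiff ℝ ∞ a := ofRealCLM.contDiff.comp Real.smoothTransition.contDiff
    rcases n with _ | n
    · refine ⟨1, fun x => ?_⟩
      simp only [Function.iterate_zero, id, a, norm_real, Real.norm_eq_abs,
        abs_of_nonneg (Real.smoothTransition.nonneg x)]
      exact Real.smoothTransition.le_one x
    · have h0 : HasCompactSupport (_root_.deriv a) := by
        refine HasCompactSupport.intro (isCompact_Icc (a := (0 : ℝ)) (b := 1)) fun x hx => ?_
        rw [Set.mem_Icc, not_and_or, not_le, not_le] at hx
        rcases hx with hx | hx
        · have : a =ᶠ[nhds x] fun _ => 0 := Filter.eventually_of_mem (Iio_mem_nhds hx)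
            fun y hy => by simp [a, Real.smoothTransition.zero_of_nonpos (le_of_lt hy)]
          exact this.deriv_eq.trans (deriv_const _ _)
        · have : a =ᶠ[nhds x] fun _ => 1 := Filter.eventually_of_mem (Ioi_mem_nhds hx)
            fun y hy => by simp [a, Real.smoothTransition.one_of_one_le (le_of_lt hy)]
          exact this.deriv_eq.trans (deriv_const _ _)
      have h1 : HasCompactSupport (_root_.deriv^[n + 1] a) := by
        rw [Function.iterate_succ_apply]
        clear_value a
        clear ha
        induction n with
        | zero => exact h0
        | succ n ih => rw [Function.iterate_succ_apply']; exact ih.deriv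
      exact (ha.iterate_deriv (n + 1)).continuous.bounded_above_of_compact_support h1

/-- The amplitudes: smooth periodic functions vanishing where `Im C > -d`. -/
structure IsAmplitude (C : SmoothCircleFun) (d : ℝ) (p : ℝ → ℂ) : Prop where
  smooth : ContDiff ℝ ∞ p
  periodic : Function.Periodic p (2 * Real.pi)
  zero : ∀ t, -d < (C t).im → p t = 0

theorem IsAmplitude.mul {C : SmoothCircleFun} {d : ℝ} {p : ℝ → ℂ} (hp : IsAmplitude C d p)
    (r : SmoothCircleFun) : IsAmplitude C d (fun t => r t * p t) where
  smooth := r.smooth.mul hp.smooth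
  periodic t := by simp only [hp.periodic t, r.periodic t]
  zero t ht := by rw [hp.zero t ht, mul_zero]

theorem IsAmplitude.const_mul {C : SmoothCircleFun} {d : ℝ} {p : ℝ → ℂ} (hp : IsAmplitude C d p)
    (r : ℂ) : IsAmplitude C d (fun t => r * p t) :=
  hp.mul ⟨fun _ => r, contDiff_const, fun _ => rfl⟩

theorem IsAmplitude.sub {C : SmoothCircleFun} {d : ℝ} {p r : ℝ → ℂ} (hp : IsAmplitude C d p)
    (hr : IsAmplitude C d r) : IsAmplitude C d (fun t => p t - r t) where
  smooth := hp.smooth.sub hr.smooth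
  periodic t := by simp only [hp.periodic t, hr.periodic t]
  zero t ht := by rw [hp.zero t ht, hr.zero t ht, sub_zero]

theorem IsAmplitude.deriv {C : SmoothCircleFun} {d : ℝ} {p : ℝ → ℂ} (hp : IsAmplitude C d p) :
    IsAmplitude C d (deriv p) where
  smooth := hp.smooth.iterate_deriv 1
  periodic := (SmoothCircleFun.der ⟨p, hp.smooth, hp.periodic⟩).periodic
  zero t ht := by
    have hopen : IsOpen {t | -d < (C t).im} :=
      isOpen_lt continuous_const (Complex.continuous_im.comp C.smooth.continuous)
    have : p =ᶠ[nhds t] fun _ => 0 := Filter.eventually_of_mem (hopen.mem_nhds ht) hp.zero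
    exact this.deriv_eq.trans (deriv_const _ _)

/-- The function `p(t) x^j a(x - R) exp (-(2πi x C(t) + Q(t)))`. -/
def wave (C Q p : ℝ → ℂ) (j : ℕ) (a : ℝ → ℂ) (R : ℝ) : ℝ × ℝ → ℂ := fun z =>
  p z.1 * (z.2 : ℂ) ^ j * a (z.2 - R) * cexp (-(2 * Real.pi * I * z.2 * C z.1 + Q z.1))

section Wave

variable (C Q : SmoothCircleFun)

theorem smooth_wave {p a : ℝ → ℂ} (hp : ContDiff ℝ ∞ p) (ha : ContDiff ℝ ∞ a) (j : ℕ) (R : ℝ) :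
    ContDiff ℝ ∞ (wave C Q p j a R) := by
  have hx : ContDiff ℝ ∞ fun z : ℝ × ℝ => (z.2 : ℂ) := ofRealCLM.contDiff.comp contDiff_snd
  have hC : ContDiff ℝ ∞ fun z : ℝ × ℝ => C z.1 := C.smooth.comp contDiff_fst
  have hQ : ContDiff ℝ ∞ fun z : ℝ × ℝ => Q z.1 := Q.smooth.comp contDiff_fst
  have hp' : ContDiff ℝ ∞ fun z : ℝ × ℝ => p z.1 := hp.comp contDiff_fst
  have ha' : ContDiff ℝ ∞ fun z : ℝ × ℝ => a (z.2 - R) :=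
    ha.comp (contDiff_snd.sub contDiff_const)
  exact ((hp'.mul (hx.pow j)).mul ha').mul (((contDiff_const.mul hx).mul hC).add hQ).neg.cexp

theorem periodicT_wave {p : ℝ → ℂ} (hp : Function.Periodic p (2 * Real.pi)) (j : ℕ) (a : ℝ → ℂ)
    (R : ℝ) : PeriodicT (wave C Q p j a R) := by
  intro t x
  simp only [wave, hp t, C.periodic t, Q.periodic t]

theorem dt_wave {p : ℝ → ℂ} (hp : ContDiff ℝ ∞ p) (j : ℕ) (a : ℝ → ℂ) (R : ℝ) :
    dt (wave C Q p j a R) = wave C Q (fun t => deriv p t - Q.der t * p t) j a R +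
      wave C Q (fun t => (-2 * Real.pi * I) * (C.der t * p t)) (j + 1) a R := by
  funext z
  have h1 := (hp.differentiable (by simp) z.1).hasDerivAt
  have h2 := (C.smooth.differentiable (by simp) z.1).hasDerivAt
  have h3 := (Q.smooth.differentiable (by simp) z.1).hasDerivAt
  have h := (((h1.mul_const ((z.2 : ℂ) ^ j)).mul_const (a (z.2 - R))).fun_mul
    (((h2.const_mul (2 * Real.pi * I * z.2)).fun_add h3).fun_neg.cexp)).deriv
  refine h.trans ?_
  simp only [wave, Pi.add_apply, SmoothCircleFun.der]
  ring

/-- For `j = 0` the truncated exponent `j - 1` is harmless because the coefficient `j` is zero. -/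
theorem dx_wave (p : ℝ → ℂ) {a : ℝ → ℂ} (ha : ContDiff ℝ ∞ a) (j : ℕ) (R : ℝ) :
    dx (wave C Q p j a R) = wave C Q (fun t => (j : ℂ) * p t) (j - 1) a R +
      (wave C Q p j (deriv a) R +
        wave C Q (fun t => (-2 * Real.pi * I) * (C t * p t)) j a R) := by
  funext z
  have h0 : HasDerivAt (fun y : ℝ => (y : ℂ)) 1 z.2 := ofRealCLM.hasDerivAt
  have h1 : HasDerivAt (fun y : ℝ => a (y - R)) (deriv a (z.2 - R)) z.2 :=
    (ha.differentiable (by simp) (z.2 - R)).hasDerivAt.comp_sub_const z.2 R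
  have h := ((((h0.fun_pow j).const_mul (p z.1)).fun_mul h1).fun_mul
    ((((h0.const_mul (2 * Real.pi * I)).mul_const (C z.1)).add_const (Q z.1)).fun_neg.cexp)).deriv
  refine h.trans ?_
  simp only [wave, Pi.add_apply]
  ring

/-- Rapid decay of a family of functions indexed by `R ≥ 0`, with a gain of `(1 + R)⁻¹`. -/
def UDecays (F : ℝ → ℝ × ℝ → ℂ) : Prop :=
  ∀ γ : ℕ, ∃ D : ℝ, ∀ R, 0 ≤ R → ∀ z : ℝ × ℝ, (1 + R) * (|z.2| ^ γ * ‖F R z‖) ≤ D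

theorem UDecays.add {F G : ℝ → ℝ × ℝ → ℂ} (hF : UDecays F) (hG : UDecays G) :
    UDecays fun R => F R + G R := by
  intro γ
  obtain ⟨D, hD⟩ := hF γ
  obtain ⟨D', hD'⟩ := hG γ
  refine ⟨D + D', fun R hR z => ?_⟩
  have h : ‖(F R + G R) z‖ ≤ ‖F R z‖ + ‖G R z‖ := norm_add_le _ _
  calc _ ≤ (1 + R) * (|z.2| ^ γ * (‖F R z‖ + ‖G R z‖)) := by gcongr
    _ = (1 + R) * (|z.2| ^ γ * ‖F R z‖) + (1 + R) * (|z.2| ^ γ * ‖G R z‖) := by ring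
    _ ≤ D + D' := add_le_add (hD R hR z) (hD' R hR z)

theorem UDecays.decays {F : ℝ → ℝ × ℝ → ℂ} (hF : UDecays F) {R : ℝ} (hR : 0 ≤ R) :
    Decays (F R) := by
  intro γ
  obtain ⟨D, hD⟩ := hF γ
  refine ⟨D, fun z => le_trans ?_ (hD R hR z)⟩
  exact le_mul_of_one_le_left (by positivity) (by linarith)

theorem exists_pow_mul_exp_le (n : ℕ) {d : ℝ} (hd : 0 < d) :
    ∃ D : ℝ, ∀ x, 0 ≤ x → (1 + x) ^ n * Real.exp (-(d * x)) ≤ D := by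
  refine ⟨n.factorial * Real.exp d / d ^ n, fun x hx => ?_⟩
  have h := Real.pow_div_factorial_le_exp (d * (1 + x)) (by positivity) n
  rw [div_le_iff₀ (by positivity), mul_pow] at h
  rw [le_div_iff₀ (by positivity), Real.exp_neg]
  have e : Real.exp (d * (1 + x)) = Real.exp d * Real.exp (d * x) := by
    rw [← Real.exp_add]; ring_nf
  rw [e] at h
  have := Real.exp_pos (d * x)
  calc (1 + x) ^ n * (Real.exp (d * x))⁻¹ * d ^ n
      = (d ^ n * (1 + x) ^ n) * (Real.exp (d * x))⁻¹ := by ring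
    _ ≤ (Real.exp d * Real.exp (d * x) * n.factorial) * (Real.exp (d * x))⁻¹ := by gcongr
    _ = n.factorial * Real.exp d := by field_simp

theorem norm_exp_wave (t x : ℝ) :
    ‖cexp (-(2 * Real.pi * I * x * C t + Q t))‖ =
      Real.exp (2 * Real.pi * x * (C t).im - (Q t).re) := by
  rw [Complex.norm_exp]
  congr 1
  simp
  ring

variable {d : ℝ}

/-- Where the wave is nonzero, `x ≥ R ≥ 0` and `Im C ≤ -d`, so the exponential is at most a constant
times `e^{-2πdx}`. This absorbs every power of `x`, and also the factor `1 + R ≤ 1 + x`. -/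
theorem uDecays_wave (hd : 0 < d) {p a : ℝ → ℂ} (hp : IsAmplitude C d p) (ha : IsCutoff a)
    (j : ℕ) : UDecays (wave C Q p j a) := by
  intro γ
  obtain ⟨P, hP⟩ := SmoothCircleFun.bounded ⟨p, hp.smooth, hp.periodic⟩
  obtain ⟨A, hA⟩ := ha.bounded 0
  obtain ⟨K, hK⟩ := Q.bounded
  obtain ⟨D, hD⟩ := exists_pow_mul_exp_le (1 + γ + j) (d := 2 * Real.pi * d) (by positivity)
  have hP0 : 0 ≤ P := (norm_nonneg _).trans (hP 0)
  have hA0 : 0 ≤ A := (norm_nonneg _).trans (hA 0)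
  have hD0 : 0 ≤ D := le_trans (by positivity) (hD 0 le_rfl)
  refine ⟨P * A * Real.exp K * D, fun R hR z => ?_⟩
  obtain ⟨t, x⟩ := z
  by_cases hx : x < R
  · have : wave C Q p j a R (t, x) = 0 := by
      simp [wave, ha.zero (x - R) (by linarith)]
    rw [this, norm_zero, mul_zero, mul_zero]; positivity
  by_cases ht : -d < (C t).im
  · have : wave C Q p j a R (t, x) = 0 := by simp [wave, hp.zero t ht]
    rw [this, norm_zero, mul_zero, mul_zero]; positivity
  rw [not_lt] at hx ht
  have hx0 : 0 ≤ x := hR.trans hx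
  have hpi := Real.pi_pos
  have h1 : ‖cexp (-(2 * Real.pi * I * x * C t + Q t))‖ ≤
      Real.exp K * Real.exp (-(2 * Real.pi * d * x)) := by
    rw [norm_exp_wave, ← Real.exp_add]
    refine Real.exp_le_exp.2 ?_
    have h2 := (Complex.abs_re_le_norm (Q t)).trans (hK t)
    have h3 := (abs_le.1 h2).1
    have h4 : 2 * Real.pi * x * (C t).im ≤ 2 * Real.pi * x * (-d) := by gcongr
    linarith
  have h5 : ‖wave C Q p j a R (t, x)‖ ≤
      P * x ^ j * A * (Real.exp K * Real.exp (-(2 * Real.pi * d * x))) := by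
    simp only [wave, norm_mul, norm_pow, norm_real, Real.norm_eq_abs, abs_of_nonneg hx0]
    have h6 : ‖p t‖ ≤ P := hP t
    have h7 : ‖a (x - R)‖ ≤ A := hA _
    gcongr
  have h8 : x ≤ 1 + x := by linarith
  calc (1 + R) * (|x| ^ γ * ‖wave C Q p j a R (t, x)‖)
      ≤ (1 + x) * ((1 + x) ^ γ *
        (P * (1 + x) ^ j * A * (Real.exp K * Real.exp (-(2 * Real.pi * d * x))))) := by
        rw [abs_of_nonneg hx0]
        have h9 : x ^ j ≤ (1 + x) ^ j := by gcongr
        refine mul_le_mul (by linarith) (mul_le_mul (by gcongr) (h5.trans (by gcongr))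
          (norm_nonneg _) (by positivity)) (by positivity) (by positivity)
    _ = P * A * Real.exp K * ((1 + x) ^ (1 + γ + j) * Real.exp (-(2 * Real.pi * d * x))) := by
        ring
    _ ≤ P * A * Real.exp K * D := by gcongr; exact hD x hx0

/-- Derivatives of waves are sums of waves whose amplitudes and cutoffs stay in the same classes, so
the undifferentiated bound suffices. -/
theorem uDecays_dx_dt_wave (hd : 0 < d) (β : ℕ) : ∀ (α : ℕ) {p a : ℝ → ℂ}, IsAmplitude C d p →
    IsCutoff a → ∀ j, UDecays fun R => dx^[β] (dt^[α] (wave C Q p j a R)) := by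
  have hb : ∀ {p a : ℝ → ℂ}, IsAmplitude C d p →
      IsCutoff a → ∀ j, UDecays fun R => dx^[β] (wave C Q p j a R) := by
    induction β with
    | zero => exact fun hp ha j => uDecays_wave C Q hd hp ha j
    | succ β ih =>
      intro p a hp ha j
      have h1 := hp.const_mul (j : ℂ)
      have h2 := ((hp.mul C).const_mul (-2 * Real.pi * I))
      have := (ih h1 ha (j - 1)).add ((ih hp ha.deriv j).add (ih h2 ha j))
      convert this using 2 with R
      rw [Function.iterate_succ_apply, dx_wave C Q p ha.smooth,
        dx_iter_add (smooth_wave C Q h1.smooth ha.smooth _ _)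
          (smooth_add (smooth_wave C Q hp.smooth ha.deriv.smooth _ _)
            (smooth_wave C Q h2.smooth ha.smooth _ _)),
        dx_iter_add (smooth_wave C Q hp.smooth ha.deriv.smooth _ _)
            (smooth_wave C Q h2.smooth ha.smooth _ _)]
  intro α
  induction α with
  | zero => exact fun hp ha j => hb hp ha j
  | succ α ih =>
    intro p a hp ha j
    have h1 := hp.deriv.sub (hp.mul Q.der)
    have h2 := ((hp.mul C.der).const_mul (-2 * Real.pi * I))
    have s1 := fun R => smooth_wave C Q h1.smooth ha.smooth j R
    have s2 := fun R => smooth_wave C Q h2.smooth ha.smooth (j + 1) R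
    have := (ih h1 ha j).add (ih h2 ha (j + 1))
    convert this using 2 with R
    rw [Function.iterate_succ_apply, dt_wave C Q hp.smooth, dt_iter_add (s1 R) (s2 R),
      dx_iter_add (smooth_dt_iter (s1 R) _) (smooth_dt_iter (s2 R) _)]

theorem dt_iter_dx_iter {f : ℝ × ℝ → ℂ} (hf : ContDiff ℝ ∞ f) (α β : ℕ) :
    dt^[α] (dx^[β] f) = dx^[β] (dt^[α] f) := by
  induction α with
  | zero => rfl
  | succ α ih =>
    rw [Function.iterate_succ_apply', ih, ← dx_iter_dt (smooth_dt_iter hf α),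
      Function.iterate_succ_apply']

theorem isSchwartz_wave (hd : 0 < d) {p a : ℝ → ℂ} (hp : IsAmplitude C d p) (ha : IsCutoff a)
    (j : ℕ) {R : ℝ} (hR : 0 ≤ R) : IsSchwartz (wave C Q p j a R) where
  smooth := smooth_wave C Q hp.smooth ha.smooth j R
  periodic := periodicT_wave C Q hp.periodic j a R
  decay α β := by
    rw [dt_iter_dx_iter (smooth_wave C Q hp.smooth ha.smooth j R)]
    exact (uDecays_dx_dt_wave C Q hd β α hp ha j).decays hR

theorem xm_iter_wave (p : ℝ → ℂ) (j : ℕ) (a : ℝ → ℂ) (R : ℝ) (n : ℕ) :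
    xm^[n] (wave C Q p j a R) = wave C Q (fun t => (-2 * Real.pi * I) ^ n * p t) (j + n) a R := by
  induction n with
  | zero => simp
  | succ n ih =>
    rw [Function.iterate_succ_apply', ih]
    funext z
    simp only [xm, xmul, wave, Pi.smul_apply, smul_eq_mul]
    ring

/-- The inverse partial Fourier transform of a wave, as a Schwartz function. -/
def waveInv (hd : 0 < d) {p a : ℝ → ℂ} (hp : IsAmplitude C d p) (ha : IsCutoff a) {R : ℝ}
    (hR : 0 ≤ R) : SchwartzTR :=
  ⟨pFinv (wave C Q p 0 a R), isSchwartz_pFinv (isSchwartz_wave C Q hd hp ha 0 hR)⟩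

/-- The transform exchanges powers of `x` with `x`-derivatives, so each seminorm is controlled by an
integral of a differentiated wave. The decay bounds of orders `0` and `2` make it integrable and
keep the gain `(1 + R)⁻¹`. -/
theorem seminormTR_waveInv_le (hd : 0 < d) {p a : ℝ → ℂ} (hp : IsAmplitude C d p)
    (ha : IsCutoff a) (α β γ : ℕ) :
    ∃ D, ∀ R, ∀ hR : 0 ≤ R, seminormTR α β γ (waveInv C Q hd hp ha hR) ≤ D / (1 + R) := by
  have hp' := hp.const_mul ((-2 * Real.pi * I) ^ β)
  have hu := uDecays_dx_dt_wave C Q hd γ α hp' ha (0 + β)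
  obtain ⟨D₀, hD₀⟩ := hu 0
  obtain ⟨D₂, hD₂⟩ := hu 2
  refine ⟨((2 * Real.pi) ^ γ)⁻¹ * ((D₀ + D₂) * Real.pi), fun R hR => ?_⟩
  have hS := isSchwartz_wave C Q hd hp ha 0 hR
  have hR1 : 0 < 1 + R := by linarith
  have bound : ∀ z : ℝ × ℝ, |z.2| ^ γ * ‖dt^[α] (dx^[β] (pF (wave C Q p 0 a R))) z‖ ≤
      ((2 * Real.pi) ^ γ)⁻¹ * ((D₀ + D₂) * Real.pi) / (1 + R) := by
    intro z
    have h1 := isSchwartz_dt_iter (isSchwartz_xm_iter hS β) α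
    rw [dx_iter_pF hS, dt_iter_pF (isSchwartz_xm_iter hS β), pow_mul_pF h1, mul_div_assoc]
    refine mul_le_mul_of_nonneg_left ?_ (by positivity)
    rw [mul_div_right_comm]
    refine pF_norm_le_of_bound (h1.dx_iter γ) (fun t x => ?_) z
    rw [xm_iter_wave]
    have h2 := hD₀ R hR (t, x)
    have h3 := hD₂ R hR (t, x)
    simp only [pow_zero, one_mul, sq_abs] at h2 h3
    rw [← div_eq_mul_inv, div_div, le_div_iff₀ (by positivity)]
    linarith
  refine Real.iSup_le (fun z => ?_) ((by positivity : (0 : ℝ) ≤ |(0 : ℝ × ℝ).2| ^ γ * _).trans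
    (bound 0))
  have h := bound (z.1, -z.2)
  simp only [waveInv, pFinv]
  rw [dx_iter_refl, dt_iter_smul, dt_iter_refl]
  simpa [refl, norm_smul] using h

theorem pN_waveInv_le (hd : 0 < d) {p a : ℝ → ℂ} (hp : IsAmplitude C d p)
    (ha : IsCutoff a) (N : ℕ) :
    ∃ D, ∀ R, ∀ hR : 0 ≤ R, pN N (waveInv C Q hd hp ha hR) ≤ D / (1 + R) := by
  choose D hD using seminormTR_waveInv_le C Q hd hp ha
  refine ⟨∑ i ∈ (Finset.range (N + 1) ×ˢ Finset.range (N + 1) ×ˢ Finset.range (N + 1)).filter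
    (fun i => i.1 + i.2.1 + i.2.2 ≤ N), D i.1 i.2.1 i.2.2, fun R hR => ?_⟩
  rw [Finset.sum_div]
  exact Finset.sum_le_sum fun i _ => hD i.1 i.2.1 i.2.2 R hR

end Wave

/-! ### Nonsolvability when the sign changes -/

theorem PeriodicT.dt {f : ℝ × ℝ → ℂ} (hf : PeriodicT f) : PeriodicT (dt f) := by
  intro t x
  have h : (fun s : ℝ => f (s + 2 * Real.pi, x)) = fun s => f (s, x) := funext fun s => hf s x
  exact (deriv_comp_add_const (fun s : ℝ => f (s, x)) (2 * Real.pi) t).symm.trans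
    (by rw [h]; rfl)

theorem isSchwartz_of_support {f : ℝ × ℝ → ℂ} (hf : ContDiff ℝ ∞ f) (hper : PeriodicT f) {ρ : ℝ}
    (hρ : ∀ t x, ρ < |x| → f (t, x) = 0) : IsSchwartz f where
  smooth := hf
  periodic := hper
  decay α β γ := by
    have hs := smooth_dt_iter (smooth_dx_iter hf β) α
    have hp : PeriodicT (dt^[α] (dx^[β] f)) := by
      induction α with
      | zero => exact hper.dx_iter β
      | succ α ih =>
        rw [Function.iterate_succ_apply']
        exact (ih (smooth_dt_iter (smooth_dx_iter hf β) α)).dt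
    have hz0 : ∀ t x, ρ < |x| → dx^[β] f (t, x) = 0 := fun t =>
      dx_iter_eq_zero (S := {x | ρ < |x|}) (isOpen_lt continuous_const continuous_abs) (hρ t) β
    have hz : ∀ t x, ρ < |x| → dt^[α] (dx^[β] f) (t, x) = 0 := by
      clear hs hp
      induction α with
      | zero => exact hz0
      | succ α ih =>
        intro t x hx
        rw [Function.iterate_succ_apply']
        have : (fun s : ℝ => dt^[α] (dx^[β] f) (s, x)) = fun _ => 0 := funext fun s => ih s x hx
        exact (congrArg (fun g : ℝ → ℂ => deriv g t) this).trans (deriv_const _ _)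
    obtain ⟨D, hD⟩ := hp.bounded hs.continuous (max ρ 0)
    have hD0 : 0 ≤ D := (norm_nonneg _).trans (hD 0 0 (by simp))
    refine ⟨max ρ 0 ^ γ * D, fun z => ?_⟩
    by_cases hz' : ρ < |z.2|
    · rw [hz z.1 z.2 hz', norm_zero, mul_zero]; positivity
    · have h1 : |z.2| ≤ max ρ 0 := (not_lt.1 hz').trans (le_max_left _ _)
      exact mul_le_mul (pow_le_pow_left₀ (abs_nonneg _) h1 γ) (hD z.1 z.2 h1) (norm_nonneg _)
        (by positivity)

/-- `e^Φ (V - W)` is constant in `t`. Comparing `t = 0` with `t = 2π` forces the constant to be zero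
off resonance. -/
theorem symP_unique (c q : SmoothCircleFun) {V W : ℝ × ℝ → ℂ} (hV : ContDiff ℝ ∞ V)
    (hW : ContDiff ℝ ∞ W) (hVp : PeriodicT V) (hWp : PeriodicT W)
    (h : symP c q V = symP c q W) {x : ℝ} (hx : cexp (phase c q (2 * Real.pi, x)) ≠ 1) (t : ℝ) :
    V (t, x) = W (t, x) := by
  have hd : ∀ t, HasDerivAt (fun t => cexp (phase c q (t, x)) * (V (t, x) - W (t, x))) 0 t := by
    intro t
    refine ((hasDerivAt_phase c q t x).cexp.mul ((hasDerivAt_of_symP c q hV x t).sub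
      (hasDerivAt_of_symP c q hW x t))).congr_deriv ?_
    rw [h, Pi.sub_apply]; ring
  have hconst := is_const_of_deriv_eq_zero (fun t => (hd t).differentiableAt)
    (fun t => (hd t).deriv)
  have h0 : phase c q (0, x) = 0 := by simp [phase, prim]
  have e0 := hconst (2 * Real.pi) 0
  have hv := hVp 0 x
  have hw := hWp 0 x
  rw [zero_add] at hv hw
  rw [h0, Complex.exp_zero, hv, hw] at e0
  have e1 : (cexp (phase c q (2 * Real.pi, x)) - 1) * (V (0, x) - W (0, x)) = 0 := by
    linear_combination e0
  have e2 := (mul_eq_zero.1 e1).resolve_left (sub_ne_zero.2 hx)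
  have e3 := hconst t 0
  rw [e2, mul_zero] at e3
  exact sub_eq_zero.1 ((mul_eq_zero.1 e3).resolve_left (Complex.exp_ne_zero _))

/-- The resonant set is countable: it is empty when `c₀ = 0` and `q₀ ∉ iℤ`, and otherwise it is the
preimage of `2πiℤ` under an injective affine function of `x`. -/
theorem exists_nonresonant (c q : SmoothCircleFun)
    (hcq : mean c ≠ 0 ∨ ¬ ∃ k : ℤ, mean q = I * (k : ℂ)) (X : ℝ) :
    ∃ x, X < x ∧ cexp (phase c q (2 * Real.pi, x)) ≠ 1 := by
  have hpi : (Real.pi : ℂ) ≠ 0 := by exact_mod_cast Real.pi_ne_zero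
  have hcount : {x : ℝ | cexp (phase c q (2 * Real.pi, x)) = 1}.Countable := by
    by_cases hc : mean c = 0
    · convert Set.countable_empty
      ext x
      simp only [Set.mem_ofPred_eq, Set.mem_empty_iff_false, iff_false]
      intro hx
      obtain ⟨n, hn⟩ := Complex.exp_eq_one_iff.1 hx
      refine (hcq.resolve_left (not_not.2 hc)) ⟨n, ?_⟩
      simp only [phase, two_pi_mul_mean, hc, mul_zero, zero_add] at hn
      refine mul_left_cancel₀ (mul_ne_zero two_ne_zero hpi) (hn.trans ?_)
      ring
    · have hinj : Function.Injective fun x : ℝ => phase c q (2 * Real.pi, x) := by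
        intro x y hxy
        simp only [phase, two_pi_mul_mean] at hxy
        have h1 : (2 * Real.pi * I * (2 * Real.pi * mean c)) * x =
            (2 * Real.pi * I * (2 * Real.pi * mean c)) * (y : ℂ) := by linear_combination hxy
        have h2 := mul_left_cancel₀ (by simp [hpi, hc]) h1
        exact_mod_cast h2
      refine ((Set.countable_range fun n : ℤ => (n : ℂ) * (2 * Real.pi * I)).preimage hinj).mono ?_
      intro x hx
      obtain ⟨n, hn⟩ := Complex.exp_eq_one_iff.1 hx
      exact ⟨n, hn.symm⟩
  obtain ⟨x, hx, h⟩ := (hcount.dense_compl ℝ).exists_mem_open isOpen_Ioi (Set.nonempty_Ioi (a := X))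
  exact ⟨x, h, hx⟩

theorem exists_periodic_primitive (c ψ : SmoothCircleFun) (hψ : prim ψ (2 * Real.pi) ≠ 0) :
    ∃ C : SmoothCircleFun, ∀ t,
      HasDerivAt C (c t - prim c (2 * Real.pi) / prim ψ (2 * Real.pi) * ψ t) t := by
  refine ⟨⟨fun t => prim c t - prim c (2 * Real.pi) / prim ψ (2 * Real.pi) * prim ψ t,
    (smooth_prim c).sub (contDiff_const.mul (smooth_prim ψ)), fun t => ?_⟩, fun t => ?_⟩
  · simp only [prim_add]
    field_simp
    ring
  · exact (hasDerivAt_prim c.smooth.continuous t).fun_sub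
      ((hasDerivAt_prim ψ.smooth.continuous t).const_mul _)

/-- If `Im c` changes sign there are periodic primitives of modifications of `c` and `q`, for
which the maximum of the imaginary part is away from the support of the modification. -/
theorem exists_modified_primitives (c q : SmoothCircleFun) (hpos : ∃ t, 0 < (c t).im)
    (hneg : ∃ t, (c t).im < 0) :
    ∃ (C Q ψ : SmoothCircleFun) (k l : ℂ) (e a : ℝ), (∀ t, HasDerivAt C (c t - k * ψ t) t) ∧
      (∀ t, HasDerivAt Q (q t - l * ψ t) t) ∧ 0 < e ∧ (∀ t, ψ t ≠ 0 → (C t).im ≤ -e) ∧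
      0 < (C a).im := by
  have hpi := Real.pi_pos
  -- This sign ensures that removing the mean of `b` by a multiple of a bump placed where `σ b < -δ`
  -- only pushes `σ b` further down there.
  obtain ⟨σ, t₀, hσ, ht₀⟩ : ∃ σ t₀ : ℝ, 0 ≤ σ * (prim c (2 * Real.pi)).im ∧
      σ * (c t₀).im < 0 := by
    rcases le_total 0 (prim c (2 * Real.pi)).im with h | h
    · obtain ⟨t, ht⟩ := hneg
      exact ⟨1, t, by simpa using h, by simpa using ht⟩
    · obtain ⟨t, ht⟩ := hpos
      exact ⟨-1, t, by simpa using h, by simpa using ht⟩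
  obtain ⟨δ, hδ, hδ'⟩ : ∃ δ, 0 < δ ∧ σ * (c t₀).im < -δ :=
    ⟨-(σ * (c t₀).im) / 2, by linarith, by linarith⟩
  have hbs : ContDiff ℝ ∞ fun t => (c t).im := imCLM.contDiff.comp c.smooth
  let φ : ℝ → ℝ := fun t => expNegInvGlue (-(σ * (c t).im) - δ)
  have hφs : ContDiff ℝ ∞ φ :=
    expNegInvGlue.contDiff.comp ((contDiff_const.mul hbs).neg.sub contDiff_const)
  have hφp : Function.Periodic φ (2 * Real.pi) := fun t => by simp only [φ, c.periodic t]
  let ψ : SmoothCircleFun := ⟨fun t => (φ t : ℂ), ofRealCLM.contDiff.comp hφs,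
    fun t => by simp only [hφp t]⟩
  obtain ⟨J, hJ, hJψ⟩ : ∃ J : ℝ, 0 < J ∧ prim ψ (2 * Real.pi) = J := by
    refine ⟨∫ t in (0 : ℝ)..2 * Real.pi, φ t, ?_, intervalIntegral.integral_ofReal⟩
    obtain ⟨s, hs, e⟩ := hφp.exists_mem_Ico₀ (by positivity) t₀
    refine intervalIntegral.integral_pos (by positivity) hφs.continuous.continuousOn
      (fun x _ => expNegInvGlue.nonneg _) ⟨s, ⟨hs.1, hs.2.le⟩, ?_⟩
    rw [← e]
    exact expNegInvGlue.pos_of_pos (by linarith)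
  have hψ0 : prim ψ (2 * Real.pi) ≠ 0 := by rw [hJψ]; exact_mod_cast hJ.ne'
  obtain ⟨C, hC⟩ := exists_periodic_primitive c ψ hψ0
  obtain ⟨Q, hQ⟩ := exists_periodic_primitive q ψ hψ0
  set B : ℝ → ℝ := fun t => (C t).im with hB
  have hBd : ∀ t, HasDerivAt B ((c t).im - (prim c (2 * Real.pi)).im / J * φ t) t := by
    intro t
    refine (imCLM.hasFDerivAt.comp_hasDerivAt t (hC t)).congr_deriv ?_
    simp only [hJψ, imCLM_apply, sub_im, ψ, im_mul_ofReal, div_ofReal_im]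
  have hBc : Continuous B := continuous_iff_continuousAt.2 fun t => (hBd t).continuousAt
  have hBp : Function.Periodic B (2 * Real.pi) := fun t => by simp only [hB, C.periodic t]
  have hIcc (t : ℝ) : ∃ s ∈ Set.Icc 0 (2 * Real.pi), B t = B s ∧ c t = c s := by
    have hp : Function.Periodic (fun t => (B t, c t)) (2 * Real.pi) := fun t => by
      simp only [hBp t, c.periodic t]
    obtain ⟨s, hs, e⟩ := hp.exists_mem_Ico₀ (by positivity) t
    exact ⟨s, ⟨hs.1, hs.2.le⟩, (Prod.ext_iff.1 e).1, (Prod.ext_iff.1 e).2⟩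
  have hKc : IsCompact (Set.Icc 0 (2 * Real.pi) ∩ {t | σ * (c t).im ≤ -δ}) :=
    isCompact_Icc.inter_right (isClosed_le (continuous_const.mul hbs.continuous) continuous_const)
  obtain ⟨s₀, hs₀, -, hs₀'⟩ := hIcc t₀
  obtain ⟨t₁, ht₁, hmax₁⟩ := hKc.exists_isMaxOn ⟨s₀, hs₀, by
    rw [Set.mem_ofPred_eq, ← hs₀']; exact hδ'.le⟩ hBc.continuousOn
  obtain ⟨a, -, hmax⟩ := isCompact_Icc.exists_isMaxOn ⟨s₀, hs₀⟩ hBc.continuousOn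
  have hglob : ∀ t, B t ≤ B a := fun t => by
    obtain ⟨s, hs, e, -⟩ := hIcc t; rw [e]; exact hmax hs
  -- On the compact set where `σ b ≤ -δ` the derivative of `B` does not vanish, so the maximum over
  -- that set is not a global one.
  have hlt : B t₁ < B a := by
    refine lt_of_le_of_ne (hglob t₁) fun h => ?_
    have hloc : IsLocalMax B t₁ := .of_forall fun t => h ▸ hglob t
    have h0 := hloc.hasDerivAt_eq_zero (hBd t₁)
    have h1 : σ * (c t₁).im ≤ -δ := ht₁.2
    have h2 : 0 ≤ σ * (prim c (2 * Real.pi)).im / J * φ t₁ :=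
      mul_nonneg (div_nonneg hσ hJ.le) (expNegInvGlue.nonneg _)
    have h3 : σ * ((c t₁).im - (prim c (2 * Real.pi)).im / J * φ t₁) =
      σ * (c t₁).im - σ * (prim c (2 * Real.pi)).im / J * φ t₁ := by ring
    rw [h0, mul_zero] at h3
    linarith
  -- Shifting by the midpoint of the two maxima puts level zero halfway between them.
  refine ⟨⟨fun t => C t - I * ((B t₁ + B a) / 2 : ℝ), C.smooth.sub contDiff_const,
    fun t => by simp only [C.periodic t]⟩, Q, ψ, _, _, (B a - B t₁) / 2, a,
    fun t => (hC t).sub_const _, hQ, by linarith, fun t ht => ?_, ?_⟩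
  · have h1 : B t ≤ B t₁ := by
      obtain ⟨s, hs, e, e'⟩ := hIcc t
      rw [e]
      refine hmax₁ ⟨hs, ?_⟩
      rw [Set.mem_ofPred_eq, ← e']
      by_contra hcon
      refine ht ?_
      simp only [ψ, φ]
      rw [expNegInvGlue.zero_of_nonpos (by linarith), ofReal_zero]
    simp only [sub_im, I_mul_im, ofReal_re]
    change B t - _ ≤ _
    linarith
  · simp only [sub_im, I_mul_im, ofReal_re]
    change 0 < B a - _
    linarith

theorem not_globallySolvable_of_sign_change (c q : SmoothCircleFun)
    (hcq : mean c ≠ 0 ∨ ¬ ∃ k : ℤ, mean q = I * (k : ℂ))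
    (hpos : ∃ t, 0 < (c t).im) (hneg : ∃ t, (c t).im < 0) : ¬ GloballySolvable c q := by
  intro hsolv
  obtain ⟨C, Q, ψ, k, l, e, t₁, hC, hQ, he, hψ, ht₁⟩ := exists_modified_primitives c q hpos hneg
  have hCs : ContDiff ℝ ∞ fun t => (C t).im := imCLM.contDiff.comp C.smooth
  -- The cutoff is `0` for `Im C ≤ -e`, which contains the support of `ψ`, and `1` for `Im C ≥
  -- -e/2`; hence `χψ = 0`, and `χ'` lives where the exponential decays.
  let χ : ℝ → ℂ := fun t => (Real.smoothTransition (2 / e * ((C t).im + e)) : ℂ)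
  have hχs : ContDiff ℝ ∞ χ := ofRealCLM.contDiff.comp (Real.smoothTransition.contDiff.comp
    (contDiff_const.mul (hCs.add contDiff_const)))
  have hχp : Function.Periodic χ (2 * Real.pi) := fun t => by simp only [χ, C.periodic t]
  have hχ1 : ∀ t, -(e / 2) ≤ (C t).im → χ t = 1 := fun t ht => by
    have : 1 ≤ 2 / e * ((C t).im + e) := by
      rw [div_mul_eq_mul_div, le_div_iff₀ he]; linarith
    simp only [χ]
    rw [Real.smoothTransition.one_of_one_le this, ofReal_one]
  have hχψ : ∀ t, χ t * ψ t = 0 := fun t => by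
    by_cases h : ψ t = 0
    · rw [h, mul_zero]
    · have h1 := hψ t h
      have : 2 / e * ((C t).im + e) ≤ 0 :=
        mul_nonpos_of_nonneg_of_nonpos (by positivity) (by linarith)
      simp only [χ]
      rw [Real.smoothTransition.zero_of_nonpos this, ofReal_zero, zero_mul]
  have hamp : IsAmplitude C (e / 2) (deriv χ) := by
    refine ⟨hχs.iterate_deriv 1, (SmoothCircleFun.der ⟨χ, hχs, hχp⟩).periodic, fun t ht => ?_⟩
    have hopen : IsOpen {t | -(e / 2) < (C t).im} := isOpen_lt continuous_const hCs.continuous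
    have : χ =ᶠ[nhds t] fun _ => 1 :=
      Filter.eventually_of_mem (hopen.mem_nhds ht) fun s hs => hχ1 s (le_of_lt hs)
    exact this.deriv_eq.trans (deriv_const _ _)
  have hd : 0 < e / 2 := by positivity
  have ha := isCutoff_smoothTransition
  set a : ℝ → ℂ := fun x => (Real.smoothTransition x : ℂ) with ha_def
  -- The exponential solves the homogeneous equation up to terms carrying `ψ`, which `χ` kills; only
  -- the derivative of `χ` remains.
  have hsymP : ∀ R, symP c q (wave C Q χ 0 a R) = wave C Q (deriv χ) 0 a R := by
    intro R
    funext z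
    have h1 : C.der z.1 = c z.1 - k * ψ z.1 := (hC z.1).deriv
    have h2 : Q.der z.1 = q z.1 - l * ψ z.1 := (hQ z.1).deriv
    rw [symP, dt_wave C Q hχs]
    simp only [Pi.add_apply, wave, h1, h2]
    linear_combination ((l + 2 * Real.pi * I * z.2 * k) * a (z.2 - R) *
      cexp (-(2 * Real.pi * I * z.2 * C z.1 + Q z.1))) * hχψ z.1
  have hws := fun R => smooth_wave C Q hχs ha.smooth 0 R
  have hwp := fun R => periodicT_wave C Q hχp 0 a R
  -- The two growing waves agree once both cutoffs have saturated, so their difference has bounded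
  -- support in `x` and is Schwartz.
  have hdiff : ∀ R, ∀ hR : 0 ≤ R, ∃ u : SchwartzTR,
      opL c q u = waveInv C Q hd hamp ha le_rfl - waveInv C Q hd hamp ha hR := by
    intro R hR
    have hS : IsSchwartz (wave C Q χ 0 a 0 + (-1 : ℂ) • wave C Q χ 0 a R) := by
      refine isSchwartz_of_support (smooth_add (hws 0) (smooth_smul _ (hws R)))
        (fun t x => ?_) (ρ := R + 1) (fun t x hx => ?_)
      · simp only [Pi.add_apply, Pi.smul_apply, hwp _ t x]
      · have : a (x - 0) = a (x - R) := by
          rcases lt_abs.1 hx with h | h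
          · simp only [ha_def]
            rw [Real.smoothTransition.one_of_one_le (by linarith),
              Real.smoothTransition.one_of_one_le (by linarith)]
          · rw [ha.zero _ (by linarith), ha.zero _ (by linarith)]
        simp only [Pi.add_apply, Pi.smul_apply, wave, this, smul_eq_mul]
        ring
    refine ⟨_, opL_eq_of_symP c q hS _ ?_⟩
    have h1 : symP c q (wave C Q χ 0 a 0 + (-1 : ℂ) • wave C Q χ 0 a R) =
        symP c q (wave C Q χ 0 a 0) + (-1 : ℂ) • symP c q (wave C Q χ 0 a R) := by
      funext z
      simp only [symP, dt_add (hws 0) (smooth_smul _ (hws R)), dt_smul, Pi.add_apply,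
        Pi.smul_apply, smul_eq_mul]
      ring
    have h2 : ((waveInv C Q hd hamp ha le_rfl - waveInv C Q hd hamp ha hR : SchwartzTR) :
        ℝ × ℝ → ℂ) = (waveInv C Q hd hamp ha le_rfl : ℝ × ℝ → ℂ) +
          (-1 : ℂ) • (waveInv C Q hd hamp ha hR : ℝ × ℝ → ℂ) := by
      rw [neg_one_smul, ← sub_eq_add_neg]; rfl
    rw [h1, h2, hsymP, hsymP, pF_add (waveInv C Q hd hamp ha le_rfl).2
      (IsSchwartz.smul _ (waveInv C Q hd hamp ha hR).2), pF_smul]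
    simp only [waveInv]
    rw [pF_pFinv (isSchwartz_wave C Q hd hamp ha 0 le_rfl),
      pF_pFinv (isSchwartz_wave C Q hd hamp ha 0 hR)]
  -- A functional killed by the transpose takes the same value on all the truncations, and these
  -- tend to zero in every seminorm as `R → ∞`.
  have hmem : waveInv C Q hd hamp ha le_rfl ∈ kerTransposeAnnihilator c q := by
    rintro v ⟨N, K, hv⟩ hLv
    obtain ⟨D, hD⟩ := pN_waveInv_le C Q hd hamp ha N
    have hb : ∀ R : ℝ, 0 ≤ R → ‖v (waveInv C Q hd hamp ha le_rfl)‖ ≤ |K| * D / (1 + R) := by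
      intro R hR
      obtain ⟨u, hu⟩ := hdiff R hR
      have h1 : v (opL c q u) = 0 := LinearMap.congr_fun hLv u
      rw [hu, map_sub, sub_eq_zero] at h1
      have hpN : 0 ≤ pN N (waveInv C Q hd hamp ha hR) :=
        Finset.sum_nonneg fun i _ => seminormTR_nonneg _ _ _ _
      rw [h1, mul_div_assoc]
      exact (hv _).trans ((mul_le_mul_of_nonneg_right (le_abs_self K) hpN).trans
        (mul_le_mul_of_nonneg_left (hD R hR) (abs_nonneg K)))
    by_contra hne
    have hpos' := norm_pos_iff.2 hne
    set y := ‖v (waveInv C Q hd hamp ha le_rfl)‖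
    have h2 := hb (|(|K| * D)| / y) (by positivity)
    rw [le_div_iff₀ (by positivity), mul_add, mul_div_cancel₀ _ hpos'.ne'] at h2
    linarith [le_abs_self (|K| * D)]
  obtain ⟨u, hu⟩ := hsolv _ hmem
  have hV := isSchwartz_pF u.2
  have hVeq : symP c q (pF u) = symP c q (wave C Q χ 0 a 0) := by
    rw [← pF_opL, hu, hsymP]
    exact pF_pFinv (isSchwartz_wave C Q hd hamp ha 0 le_rfl)
  obtain ⟨D, hD⟩ := hV.decay 0 0 0
  -- Past `1` the cutoff `a` equals `1`. Past the other threshold `2πx Im C(t₁) > |D| e^{Re Q(t₁)}`,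
  -- so `1 + y ≤ e^y` already contradicts the bound `D`.
  obtain ⟨x, hx, hres⟩ := exists_nonresonant c q hcq
    (max 1 ((|D| * Real.exp ((Q t₁).re)) / (2 * Real.pi * (C t₁).im)))
  obtain ⟨hx1, hx2⟩ := max_lt_iff.1 hx
  have heq := symP_unique c q hV.smooth (hws 0) hV.periodic (hwp 0) hVeq hres t₁
  have hbound : ‖pF u (t₁, x)‖ ≤ D := by simpa using hD (t₁, x)
  have hχt : χ t₁ = 1 := hχ1 t₁ (by linarith)
  have hax : a (x - 0) = 1 := by
    simp only [ha_def]; rw [Real.smoothTransition.one_of_one_le (by linarith), ofReal_one]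
  rw [heq] at hbound
  simp only [wave, hχt, hax, pow_zero, one_mul] at hbound
  rw [norm_exp_wave, Real.exp_sub, div_le_iff₀ (Real.exp_pos _)] at hbound
  have hpi := Real.pi_pos
  rw [div_lt_iff₀ (by positivity)] at hx2
  have h3 := Real.add_one_le_exp (2 * Real.pi * x * (C t₁).im)
  have h4 : D * Real.exp (Q t₁).re ≤ |D| * Real.exp (Q t₁).re := by
    gcongr; exact le_abs_self D
  linarith

end TorusLine

end

theorem theorem2 (c q : TorusLine.SmoothCircleFun) :
    (TorusLine.mean c = 0 →
      (∃ k : ℤ, TorusLine.mean q = Complex.I * (k : ℂ)) →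
      (∀ r : ℝ, IsPreconnected (TorusLine.sublevel (fun t => (c t).im) r)) →
      TorusLine.GloballySolvable c q) ∧
    ((∃ t : ℝ, (c t).im ≠ 0) →
      (TorusLine.mean c ≠ 0 ∨ ¬ ∃ k : ℤ, TorusLine.mean q = Complex.I * (k : ℂ)) →
      (TorusLine.GloballySolvable c q ↔
        ((∀ t : ℝ, 0 ≤ (c t).im) ∨ (∀ t : ℝ, (c t).im ≤ 0)))) := by
  refine ⟨TorusLine.globallySolvable_of_sublevel c q, fun hne hcq =>
    ⟨fun hsolv => ?_, TorusLine.globallySolvable_of_no_sign_change c q hne⟩⟩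
  by_contra! h
  exact TorusLine.not_globallySolvable_of_sign_change c q hcq h.2 h.1 hsolv
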